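/- Consider a discrete memoryless state-dependent interference channel: finite alphabets $\mathcal S_1,\mathcal S_2,\mathcal X_1,\mathcal X_2,\mathcal Y_1,\mathcal Y_2$, a joint state distribution $P_{S_1S_2}$ (the state pairs are i.i.d. over the channel uses) and a memoryless transition probability $P_{Y_1Y_2|S_1S_2X_1X_2}$. Both state sequences are known noncausally at both transmitters and at neither receiver: a code of length $n$ with message sets $\mathcal W_1,\mathcal W_2$ consists of encoders $(w_k,s_1^n,s_2^n)\mapsto x_k^n$ and decoders $y_k^n\mapsto\hat w_k\in\mathcal W_k$, $k=1,2$, and its average error probability is $$P_e^{(n)}=\frac1{|\mathcal W_1||\mathcal W_2|}\sum_{w_1,w_2}\Pr\{(\hat w_1,\hat w_2)\ne(w_1,w_2)\mid (w_1,w_2)\text{ is sent}\}.$$ A pair $(R_1,R_2)$ with $R_1,R_2\ge 0$ is achievable if there are codes of all lengths $n$ with $|\mathcal W_k|=\lceil 2^{nR_k}\rceil$, $k=1,2$, and $P_e^{(n)}\to0$ as $n\to\infty$; the capacity region is the closure of the set of achievable pairs. Then the region consisting of all pairs $(R_1,R_2)$ with $R_1,R_2\ge 0$ and $$R_1\le\min\{I(U;VY_1),\,I(U;Y_2)\}-I(S_1S_2;U),\qquad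 R_2\le\min\{I(V;UY_2),\,I(V;Y_1)\}-I(S_1S_2;V)$$ for some auxiliary random variables $U,V$ with finite alphabets and some joint distribution $P_{S_1S_2}P_{U|S_1S_2}P_{X_1|US_1S_2}P_{V|S_1S_2}P_{X_2|VS_1S_2}P_{Y_1Y_2|S_1S_2X_1X_2}$ (mutual information in bits) is an achievable region, that is, it is contained in the capacity region; moreover every pair $(R_1,R_2)$ with $R_1,R_2\ge 0$ that satisfies both inequalities strictly for some such distribution is itself achievable. -/

import Mathlib

open Filter Topology

noncomputable section

/-- The mutual information `I(A;B)`, in bits, of two finite-valued random variables `A` and `B`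
on a discrete probability space with law `p`.  Terms with `P(A = a, B = b) = 0` contribute `0`. -/
def mutualInfo {Ω α β : Type*} [Fintype α] [Fintype β] (p : PMF Ω) (A : Ω → α) (B : Ω → β) : ℝ :=
  ∑ a : α, ∑ b : β,
    (p.map (fun ω => (A ω, B ω)) (a, b)).toReal *
      Real.logb 2 ((p.map (fun ω => (A ω, B ω)) (a, b)).toReal /
        ((p.map A a).toReal * (p.map B b).toReal))

/-- A discrete memoryless state-dependent interference channel: the joint law `P_{S₁S₂}` of the two
(correlated) states and the transition probability `P_{Y₁Y₂|S₁S₂X₁X₂}` of one channel use. -/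
structure StateIC (S₁ S₂ X₁ X₂ Y₁ Y₂ : Type*) where
  /-- the joint law of the two states -/
  stateLaw : PMF (S₁ × S₂)
  /-- the channel transition probability -/
  channel : S₁ → S₂ → X₁ → X₂ → PMF (Y₁ × Y₂)

namespace StateIC

/-- A code of length `n` with `M₁` and `M₂` messages.  Both state sequences are known noncausally
at both transmitters, and at neither receiver. -/
structure Code (S₁ S₂ X₁ X₂ Y₁ Y₂ : Type*) (n M₁ M₂ : ℕ) where
  /-- encoder 1: message and the two state sequences to a codeword -/
  enc₁ : Fin M₁ → (Fin n → S₁) → (Fin n → S₂) → (Fin n → X₁)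
  /-- encoder 2 -/
  enc₂ : Fin M₂ → (Fin n → S₁) → (Fin n → S₂) → (Fin n → X₂)
  /-- decoder 1 -/
  dec₁ : (Fin n → Y₁) → Fin M₁
  /-- decoder 2 -/
  dec₂ : (Fin n → Y₂) → Fin M₂

variable {S₁ S₂ X₁ X₂ Y₁ Y₂ : Type*} [Fintype S₁] [Fintype S₂] [Fintype Y₁] [Fintype Y₂]

/-- The probability that `(ŵ₁, ŵ₂) ≠ (w₁, w₂)` when `(w₁, w₂)` is sent: the pairs of states are
i.i.d. over the channel uses and the channel is used without memory. -/
def errorProb (C : StateIC S₁ S₂ X₁ X₂ Y₁ Y₂) {n M₁ M₂ : ℕ}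
    (c : Code S₁ S₂ X₁ X₂ Y₁ Y₂ n M₁ M₂) (w₁ : Fin M₁) (w₂ : Fin M₂) : ℝ :=
  ∑ s₁ : Fin n → S₁, ∑ s₂ : Fin n → S₂,
    (∏ i, (C.stateLaw (s₁ i, s₂ i)).toReal) *
      ∑ y₁ : Fin n → Y₁, ∑ y₂ : Fin n → Y₂,
        (∏ i, (C.channel (s₁ i) (s₂ i) (c.enc₁ w₁ s₁ s₂ i) (c.enc₂ w₂ s₁ s₂ i)
          (y₁ i, y₂ i)).toReal) *
          (if (c.dec₁ y₁, c.dec₂ y₂) ≠ (w₁, w₂) then 1 else 0)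

/-- The average probability of error of a code. -/
def avgErrorProb (C : StateIC S₁ S₂ X₁ X₂ Y₁ Y₂) {n M₁ M₂ : ℕ}
    (c : Code S₁ S₂ X₁ X₂ Y₁ Y₂ n M₁ M₂) : ℝ :=
  1 / ((M₁ : ℝ) * (M₂ : ℝ)) * ∑ w₁ : Fin M₁, ∑ w₂ : Fin M₂, C.errorProb c w₁ w₂

/-- The set of achievable rate pairs (in bits per channel use): there are codes of all lengths `n`
with `⌈2^{n R₁}⌉` and `⌈2^{n R₂}⌉` messages whose average error probability tends to `0`. -/
def achievable (C : StateIC S₁ S₂ X₁ X₂ Y₁ Y₂) : Set (ℝ × ℝ) :=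
  {R | 0 ≤ R.1 ∧ 0 ≤ R.2 ∧
    ∃ c : ∀ n : ℕ, Code S₁ S₂ X₁ X₂ Y₁ Y₂ n
        ⌈(2 : ℝ) ^ ((n : ℝ) * R.1)⌉₊ ⌈(2 : ℝ) ^ ((n : ℝ) * R.2)⌉₊,
      Tendsto (fun n => C.avgErrorProb (c n)) atTop (𝓝 0)}

/-- The capacity region: the closure of the set of achievable rate pairs. -/
def capacityRegion (C : StateIC S₁ S₂ X₁ X₂ Y₁ Y₂) : Set (ℝ × ℝ) :=
  closure C.achievable

/-- The conditional laws `P_{U|S₁S₂}`, `P_{X₁|US₁S₂}`, `P_{V|S₁S₂}`, `P_{X₂|VS₁S₂}`. -/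
structure AuxLaw (S₁ S₂ X₁ X₂ U V : Type*) where
  /-- the law of `U` given the states -/
  lawU : S₁ → S₂ → PMF U
  /-- the law of `X₁` given `U` and the states -/
  lawX₁ : U → S₁ → S₂ → PMF X₁
  /-- the law of `V` given the states -/
  lawV : S₁ → S₂ → PMF V
  /-- the law of `X₂` given `V` and the states -/
  lawX₂ : V → S₁ → S₂ → PMF X₂

end StateIC

namespace StateIC

variable {S₁ S₂ X₁ X₂ Y₁ Y₂ U V : Type*}

/-- The law of `(S₁, S₂, U, V, X₁, X₂, Y₁, Y₂)` with the factorization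
`P_{S₁S₂} P_{U|S₁S₂} P_{X₁|US₁S₂} P_{V|S₁S₂} P_{X₂|VS₁S₂} P_{Y₁Y₂|S₁S₂X₁X₂}`. -/
def jointLaw (C : StateIC S₁ S₂ X₁ X₂ Y₁ Y₂) (p : AuxLaw S₁ S₂ X₁ X₂ U V) :
    PMF (S₁ × S₂ × U × V × X₁ × X₂ × Y₁ × Y₂) :=
  C.stateLaw.bind fun s =>
    (p.lawU s.1 s.2).bind fun u =>
      (p.lawX₁ u s.1 s.2).bind fun x₁ =>
        (p.lawV s.1 s.2).bind fun v =>
          (p.lawX₂ v s.1 s.2).bind fun x₂ =>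
            (C.channel s.1 s.2 x₁ x₂).map fun y => (s.1, s.2, u, v, x₁, x₂, y.1, y.2)

variable [Fintype S₁] [Fintype S₂] [Fintype Y₁] [Fintype Y₂] [Fintype U] [Fintype V]

/-- `min {I(U;VY₁), I(U;Y₂)} - I(S₁S₂;U)`. -/
def bound₁ (C : StateIC S₁ S₂ X₁ X₂ Y₁ Y₂) (p : AuxLaw S₁ S₂ X₁ X₂ U V) : ℝ :=
  min (mutualInfo (C.jointLaw p) (fun (_, _, u, _, _, _, _, _) => u)
        (fun (_, _, _, v, _, _, y₁, _) => (v, y₁)))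
      (mutualInfo (C.jointLaw p) (fun (_, _, u, _, _, _, _, _) => u)
        (fun (_, _, _, _, _, _, _, y₂) => y₂))
    - mutualInfo (C.jointLaw p) (fun (s₁, s₂, _, _, _, _, _, _) => (s₁, s₂))
        (fun (_, _, u, _, _, _, _, _) => u)

/-- `min {I(V;UY₂), I(V;Y₁)} - I(S₁S₂;V)`. -/
def bound₂ (C : StateIC S₁ S₂ X₁ X₂ Y₁ Y₂) (p : AuxLaw S₁ S₂ X₁ X₂ U V) : ℝ :=
  min (mutualInfo (C.jointLaw p) (fun (_, _, _, v, _, _, _, _) => v)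
        (fun (_, _, u, _, _, _, _, y₂) => (u, y₂)))
      (mutualInfo (C.jointLaw p) (fun (_, _, _, v, _, _, _, _) => v)
        (fun (_, _, _, _, _, _, y₁, _) => y₁))
    - mutualInfo (C.jointLaw p) (fun (s₁, s₂, _, _, _, _, _, _) => (s₁, s₂))
        (fun (_, _, _, v, _, _, _, _) => v)

end StateIC

namespace StateIC

variable {S₁ S₂ X₁ X₂ Y₁ Y₂ : Type*} [Fintype S₁] [Fintype S₂] [Fintype Y₁] [Fintype Y₂]

/-- The inner region: the pairs of (nonnegative) rates below the two bounds for some choice of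
finite alphabets of the auxiliary variables and of the conditional laws. -/
def innerRegion (C : StateIC S₁ S₂ X₁ X₂ Y₁ Y₂) : Set (ℝ × ℝ) :=
  {R | 0 ≤ R.1 ∧ 0 ≤ R.2 ∧
    ∃ (U V : Type) (_ : Fintype U) (_ : Fintype V) (p : AuxLaw S₁ S₂ X₁ X₂ U V),
      R.1 ≤ C.bound₁ p ∧ R.2 ≤ C.bound₂ p}

end StateIC

end

/-!
Random coding with likelihood encoders and joint threshold decoders.

User 1 has, for each message, `L₁` codewords drawn i.i.d. from the law of `U`, and user 2 has `L₂`
codewords drawn from the law of `V`.  Knowing the states `s`, encoder 1 picks one of the codewords of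
its message with probability proportional to the likelihood ratio `P(u | s) / P(u)`, and draws the
channel input from `P(x₁ | u, s)`; encoder 2 does the same.  In an idealized experiment the selection
probabilities are instead the likelihood ratios divided by `L₁` and `L₂`.  This is a genuine law, in
which `(S, U, V, Y₁, Y₂)` at the transmitted codewords has exactly the prescribed joint law and all
other codewords are independent of it (`sum_idealWeight_true`, `sum_idealWeight_wrong`,
`sum_idealWeight_wrong₂`).  The true selection probabilities are at most twice the idealized ones for
each user, unless the mean likelihood ratio is below `1 / 2`, which is unlikely once `L₁` and `L₂`
exceed `2 ^ (n I(S₁S₂; U))` and `2 ^ (n I(S₁S₂; V))` (soft covering, `covering_bound`).  So the error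
probability is at most four times the idealized one plus a vanishing term
(`sum_likelihood_encoder_le`), and no separate treatment of the dependence between the chosen
indices is needed.

Receiver 1 looks for a message that has a codeword `u` which, with some codeword `v` of user 2,
passes a likelihood ratio test against `y₁`.  A union bound over the wrong codewords, with the correct
or a wrong `v`, gives the conditions `R₁ + I(S;U) < I(U;VY₁)` and
`R₁ + R₂ + I(S;U) + I(S;V) < I(U;VY₁) + I(V;Y₁)`, where `S = (S₁, S₂)`.  Receiver 2 is treated in the
same way.  All this is a bound for one use of arbitrary finite alphabets (`exists_code_error_le`); it
is applied to blocks of `n` letters, where the weak law of large numbers makes the likelihood ratios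
concentrate (`tendsto_receiverBound`, `tendsto_coveringBound`), and yields `StateIC.mem_achievable`.

The two inequalities of the region imply these conditions if they are strict.  For the closure the
rates are lowered a little.  The delicate boundary points are those with a rate equal to `0`, which
cannot be lowered: there is then a single message, its receiver never errs, and the conditions of that
receiver are not needed, while the conditions of the other receiver are strict already.
-/

/-! ### Indicators and image laws -/

/-- The `0`-`1` indicator of a proposition, as a real number. -/
noncomputable def ind (P : Prop) : ℝ := open Classical in if P then 1 else 0

lemma ind_of {P : Prop} (h : P) : ind P = 1 := if_pos h

lemma ind_of_not {P : Prop} (h : ¬ P) : ind P = 0 := if_neg h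

lemma ind_nonneg (P : Prop) : 0 ≤ ind P := by
  unfold ind; split_ifs <;> norm_num

lemma ind_le_one (P : Prop) : ind P ≤ 1 := by
  unfold ind; split_ifs <;> norm_num

lemma ind_mono {P Q : Prop} (h : P → Q) : ind P ≤ ind Q := by
  by_cases hP : P
  · rw [ind_of hP, ind_of (h hP)]
  · rw [ind_of_not hP]; exact ind_nonneg Q

lemma ind_or_le (P Q : Prop) : ind (P ∨ Q) ≤ ind P + ind Q := by
  by_cases hP : P
  · rw [ind_of (Or.inl hP), ind_of hP]; linarith [ind_nonneg Q]
  · by_cases hQ : Q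
    · rw [ind_of (Or.inr hQ), ind_of hQ]; linarith [ind_nonneg P]
    · rw [ind_of_not (not_or.mpr ⟨hP, hQ⟩)]; linarith [ind_nonneg P, ind_nonneg Q]

/-- The law of `g` under the law `p`. -/
noncomputable def pushLaw {α β : Type*} [Fintype α] (p : α → ℝ) (g : α → β) (b : β) : ℝ :=
  ∑ a, p a * ind (g a = b)

/-! ### Independent identically distributed families on finite alphabets -/

section Iid

variable {ι α β : Type*} [Fintype ι] [DecidableEq ι] [Fintype α] [Fintype β]

lemma sum_prod_apply (f : ι → α → ℝ) :
    ∑ c : ι → α, ∏ i, f i (c i) = ∏ i, ∑ a, f i a := by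
  classical
  rw [Finset.prod_univ_sum, Fintype.piFinset_univ]

lemma prod_mem_stdSimplex {f : ι → α → ℝ} (hf : ∀ i, f i ∈ stdSimplex ℝ α) :
    (fun c : ι → α => ∏ i, f i (c i)) ∈ stdSimplex ℝ (ι → α) := by
  refine ⟨fun c => Finset.prod_nonneg fun i _ => (hf i).1 _, ?_⟩
  rw [sum_prod_apply f]
  simp [(hf _).2]

lemma iid_mem_stdSimplex {p : α → ℝ} (hp : p ∈ stdSimplex ℝ α) :
    (fun c : ι → α => ∏ i, p (c i)) ∈ stdSimplex ℝ (ι → α) :=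
  prod_mem_stdSimplex fun _ => hp

/-- Under an i.i.d. law each coordinate has the common law. -/
lemma sum_iid_apply {p : α → ℝ} (hp : p ∈ stdSimplex ℝ α) (i : ι) (F : α → ℝ) :
    ∑ c : ι → α, (∏ k, p (c k)) * F (c i) = ∑ a, p a * F a := by
  classical
  have h : ∀ a, ∑ c : ι → α, (∏ k, p (c k)) * (if c i = a then 1 else 0) = p a := by
    intro a
    have h1 : ∀ c : ι → α, (∏ k, p (c k)) * (if c i = a then (1 : ℝ) else 0)
        = ∏ k, p (c k) * (if k = i then (if c k = a then 1 else 0) else 1) := by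
      intro c
      rw [Finset.prod_mul_distrib, Finset.prod_ite_eq' Finset.univ i]
      simp
    simp_rw [h1]
    rw [sum_prod_apply fun k x => p x * (if k = i then (if x = a then 1 else 0) else 1)]
    rw [Finset.prod_eq_single i]
    · simp
    · intro k _ hk
      simp [hk, hp.2]
    · simp
  calc _ = ∑ c : ι → α, ∑ a, ((∏ k, p (c k)) * (if c i = a then 1 else 0)) * F a := by
        refine Finset.sum_congr rfl fun c _ => ?_
        simp
    _ = ∑ a, (∑ c : ι → α, (∏ k, p (c k)) * (if c i = a then 1 else 0)) * F a := by
        rw [Finset.sum_comm]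
        simp_rw [Finset.sum_mul]
    _ = _ := by simp_rw [h]

/-- Under an i.i.d. law two different coordinates are independent. -/
lemma sum_iid_apply₂ {p : α → ℝ} (hp : p ∈ stdSimplex ℝ α) {i j : ι} (hij : i ≠ j)
    (F : α → α → ℝ) :
    ∑ c : ι → α, (∏ k, p (c k)) * F (c i) (c j) = ∑ a, ∑ b, p a * p b * F a b := by
  classical
  have h : ∀ a b, ∑ c : ι → α, (∏ k, p (c k)) *
      ((if c i = a then 1 else 0) * (if c j = b then 1 else 0)) = p a * p b := by
    intro a b
    have h1 : ∀ c : ι → α, (∏ k, p (c k)) *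
        ((if c i = a then (1 : ℝ) else 0) * (if c j = b then 1 else 0))
        = ∏ k, p (c k) * ((if k = i then (if c k = a then 1 else 0) else 1) *
          (if k = j then (if c k = b then 1 else 0) else 1)) := by
      intro c
      rw [Finset.prod_mul_distrib, Finset.prod_mul_distrib, Finset.prod_ite_eq' Finset.univ i,
        Finset.prod_ite_eq' Finset.univ j]
      simp
    simp_rw [h1]
    rw [sum_prod_apply fun k x => p x * ((if k = i then (if x = a then 1 else 0) else 1) *
          (if k = j then (if x = b then 1 else 0) else 1))]
    rw [← Finset.prod_subset (Finset.subset_univ {i, j}), Finset.prod_pair hij]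
    · simp [hij, hij.symm]
    · intro k _ hk
      simp only [Finset.mem_insert, Finset.mem_singleton, not_or] at hk
      simp [hk.1, hk.2, hp.2]
  calc _ = ∑ c : ι → α, ∑ a, ∑ b, ((∏ k, p (c k)) *
          ((if c i = a then 1 else 0) * (if c j = b then 1 else 0))) * F a b := by
        refine Finset.sum_congr rfl fun c _ => ?_
        simp
    _ = ∑ a, ∑ b, (∑ c : ι → α, (∏ k, p (c k)) *
          ((if c i = a then 1 else 0) * (if c j = b then 1 else 0))) * F a b := by
        rw [Finset.sum_comm]
        refine Finset.sum_congr rfl fun a _ => ?_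
        rw [Finset.sum_comm]
        simp_rw [Finset.sum_mul]
    _ = _ := by simp_rw [h]

/-- The variance of a sum of centred i.i.d. variables.  The sum runs over a subfamily, given by an
injection `e` into the index set. -/
lemma sum_iid_sq {κ : Type*} [Fintype κ] {p : α → ℝ} (hp : p ∈ stdSimplex ℝ α) {e : κ → ι}
    (he : Function.Injective e) (g : α → ℝ) (hg : ∑ a, p a * g a = 0) :
    ∑ c : ι → α, (∏ k, p (c k)) * (∑ i, g (c (e i))) ^ 2
      = Fintype.card κ * ∑ a, p a * g a ^ 2 := by
  classical
  have h : ∀ i j : κ, ∑ c : ι → α, (∏ k, p (c k)) * (g (c (e i)) * g (c (e j)))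
      = if i = j then ∑ a, p a * g a ^ 2 else 0 := by
    intro i j
    split_ifs with hij
    · subst hij
      rw [sum_iid_apply hp (e i) fun a => g a * g a]
      simp_rw [sq]
    · rw [sum_iid_apply₂ hp (he.ne hij) fun a b => g a * g b]
      calc _ = ∑ a, ∑ b, (p a * g a) * (p b * g b) :=
            Finset.sum_congr rfl fun a _ => Finset.sum_congr rfl fun b _ => by ring
        _ = 0 := by simp_rw [← Finset.mul_sum, hg]; simp
  calc _ = ∑ c : ι → α, ∑ i, ∑ j, (∏ k, p (c k)) * (g (c (e i)) * g (c (e j))) := by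
        refine Finset.sum_congr rfl fun c _ => ?_
        rw [sq, Finset.sum_mul_sum]
        simp_rw [Finset.mul_sum]
    _ = ∑ i, ∑ j, ∑ c : ι → α, (∏ k, p (c k)) * (g (c (e i)) * g (c (e j))) := by
        rw [Finset.sum_comm]
        exact Finset.sum_congr rfl fun i _ => Finset.sum_comm
    _ = _ := by simp [h]

/-- The letterwise image of an i.i.d. family is i.i.d. with the image law. -/
lemma sum_iid_comp (p : α → ℝ) (g : α → β) (F : (ι → β) → ℝ) :
    ∑ c : ι → α, (∏ k, p (c k)) * F (fun k => g (c k))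
      = ∑ b : ι → β, (∏ k, pushLaw p g (b k)) * F b := by
  classical
  have h : ∀ b : ι → β, (∏ k, pushLaw p g (b k))
      = ∑ c : ι → α, if (fun k => g (c k)) = b then ∏ k, p (c k) else 0 := by
    intro b
    unfold pushLaw
    rw [← sum_prod_apply fun k a => p a * ind (g a = b k)]
    refine Finset.sum_congr rfl fun c _ => ?_
    split_ifs with hb
    · subst hb
      exact Finset.prod_congr rfl fun k _ => by rw [ind_of rfl, mul_one]
    · obtain ⟨k, hk⟩ := Function.ne_iff.mp hb
      exact Finset.prod_eq_zero (Finset.mem_univ k) (by rw [ind_of_not hk, mul_zero])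
  simp_rw [h, Finset.sum_mul]
  rw [Finset.sum_comm]
  refine Finset.sum_congr rfl fun c _ => ?_
  simp [ite_mul]

lemma sum_sum_arrow (F : (ι → α) → (ι → β) → ℝ) :
    ∑ a : ι → α, ∑ b : ι → β, F a b
      = ∑ c : ι → α × β, F (fun i => (c i).1) (fun i => (c i).2) := by
  classical
  rw [← Fintype.sum_prod_type']
  exact (Equiv.sum_comp (Equiv.arrowProdEquivProdArrow ι (fun _ => α) (fun _ => β))
    fun c => F c.1 c.2).symm

end Iid

/-- The weak law of large numbers for finitely valued i.i.d. variables. -/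
lemma tendsto_iid_deviation {α : Type*} [Fintype α] {p : α → ℝ} (hp : p ∈ stdSimplex ℝ α)
    (f : α → ℝ) {δ : ℝ} (hδ : 0 < δ) :
    Tendsto (fun n : ℕ => ∑ c : Fin n → α, (∏ k, p (c k)) *
      ind (n * δ ≤ |∑ i, f (c i) - n * ∑ a, p a * f a|))
      atTop (𝓝 0) := by
  classical
  set m := ∑ a, p a * f a with hm
  set σ := ∑ a, p a * (f a - m) ^ 2 with hσ
  have hub : Tendsto (fun n : ℕ => (σ / δ ^ 2) / (n : ℝ)) atTop (𝓝 0) :=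
    tendsto_const_div_atTop_nhds_zero_nat _
  have hnn : ∀ n, ∀ c : Fin n → α, 0 ≤ ∏ k, p (c k) :=
    fun n c => Finset.prod_nonneg fun i _ => hp.1 _
  refine tendsto_of_tendsto_of_tendsto_of_le_of_le' tendsto_const_nhds hub ?_ ?_
  · refine Eventually.of_forall fun n => Finset.sum_nonneg fun c _ =>
      mul_nonneg (hnn n c) (ind_nonneg _)
  · filter_upwards [eventually_gt_atTop 0] with n hn
    have hn' : (0 : ℝ) < n := by exact_mod_cast hn
    have hc : ∑ a, p a * (f a - m) = 0 := by
      simp_rw [mul_sub, Finset.sum_sub_distrib, ← Finset.sum_mul, hp.2, hm]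
      ring
    have key := sum_iid_sq (ι := Fin n) hp Function.injective_id (fun a => f a - m) hc
    simp only [id, Fintype.card_fin] at key
    have : σ / δ ^ 2 / n = (∑ c : Fin n → α, (∏ k, p (c k)) * (∑ i, (f (c i) - m)) ^ 2)
        / (n * δ) ^ 2 := by
      rw [key, ← hσ]
      field_simp
    rw [this, Finset.sum_div]
    refine Finset.sum_le_sum fun c _ => ?_
    rw [mul_div_assoc]
    refine mul_le_mul_of_nonneg_left ?_ (hnn n c)
    by_cases h : n * δ ≤ |∑ i, f (c i) - n * m|
    · rw [ind_of h, le_div_iff₀ (by positivity), one_mul, Finset.sum_sub_distrib]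
      simp only [Finset.sum_const, Finset.card_univ, Fintype.card_fin, nsmul_eq_mul]
      rw [← sq_abs (∑ i, f (c i) - n * m)]
      exact pow_le_pow_left₀ (by positivity) h 2
    · rw [ind_of_not h]
      positivity

/-! ### Soft covering and the likelihood encoder -/

/-- The law of the output of the kernel `q` under the input law `p`. -/
def outLaw {S U : Type*} [Fintype S] (p : S → ℝ) (q : S → U → ℝ) (u : U) : ℝ := ∑ s, p s * q s u

/-- The likelihood ratio `P(u | s) / P(u)`. -/
noncomputable def likelihood {S U : Type*} [Fintype S] (p : S → ℝ) (q : S → U → ℝ) (s : S) (u : U) :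
    ℝ := q s u / outLaw p q u

section Covering

variable {S U : Type*} [Fintype S] [Fintype U] {p : S → ℝ} {q : S → U → ℝ}

lemma outLaw_mem_stdSimplex (hp : p ∈ stdSimplex ℝ S) (hq : ∀ s, q s ∈ stdSimplex ℝ U) :
    outLaw p q ∈ stdSimplex ℝ U := by
  refine ⟨fun u => Finset.sum_nonneg fun s _ => mul_nonneg (hp.1 s) ((hq s).1 u), ?_⟩
  simp only [outLaw]
  rw [Finset.sum_comm]
  simp_rw [← Finset.mul_sum, (hq _).2, mul_one, hp.2]

lemma likelihood_nonneg (hp : p ∈ stdSimplex ℝ S) (hq : ∀ s, q s ∈ stdSimplex ℝ U) (s : S) (u : U) :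
    0 ≤ likelihood p q s u :=
  div_nonneg ((hq s).1 u) ((outLaw_mem_stdSimplex hp hq).1 u)

/-- Where the output law vanishes the likelihood ratio is a junk value; the identity holds there
too because then `p s * q s u = 0`. -/
lemma mul_outLaw_mul_likelihood (hp : p ∈ stdSimplex ℝ S) (hq : ∀ s, q s ∈ stdSimplex ℝ U) (s : S)
    (u : U) : p s * (outLaw p q u * likelihood p q s u) = p s * q s u := by
  by_cases h : outLaw p q u = 0
  · have := (Finset.sum_eq_zero_iff_of_nonneg
      (fun s _ => mul_nonneg (hp.1 s) ((hq s).1 u))).mp h s (Finset.mem_univ s)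
    rw [h, this]; ring
  · rw [likelihood, mul_div_cancel₀ _ h]

/-- Soft covering: the empirical mean of the likelihood ratios of `κ` codewords of an i.i.d. codebook
is at least `1 / 2` with high probability.  The ratios are truncated at `T` and Chebyshev's
inequality is applied to the truncated ones. -/
lemma covering_bound {ι κ : Type*} [Fintype ι] [DecidableEq ι] [Fintype κ] [Nonempty κ]
    (hp : p ∈ stdSimplex ℝ S) (hq : ∀ s, q s ∈ stdSimplex ℝ U) {e : κ → ι}
    (he : Function.Injective e) {T : ℝ} (hT : 0 ≤ T) :
    ∑ s, p s * ∑ c : ι → U, (∏ k, outLaw p q (c k)) *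
        ind (∑ l, likelihood p q s (c (e l)) < (Fintype.card κ : ℝ) / 2)
      ≤ 8 * (T / Fintype.card κ +
        ∑ s, p s * ∑ u, q s u * ind (T * outLaw p q u < q s u)) := by
  classical
  set L : ℝ := (Fintype.card κ : ℝ) with hLdef
  have hL : 0 < L := by rw [hLdef]; exact_mod_cast Fintype.card_pos
  have hP := outLaw_mem_stdSimplex hp hq
  have hPi := iid_mem_stdSimplex (ι := ι) hP
  have key : ∀ s, p s * ∑ c : ι → U, (∏ k, outLaw p q (c k)) *
        ind (∑ l, likelihood p q s (c (e l)) < L / 2)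
      ≤ p s * (8 * (T / L + ∑ u, q s u * ind (T * outLaw p q u < q s u))) := by
    intro s
    rcases (hp.1 s).eq_or_lt with h0 | hs
    · rw [← h0]; simp
    refine mul_le_mul_of_nonneg_left ?_ hs.le
    set r := likelihood p q s with hr
    have hr0 : ∀ u, 0 ≤ r u := likelihood_nonneg hp hq s
    have hPr : ∀ u, outLaw p q u * r u = q s u := fun u =>
      mul_left_cancel₀ hs.ne' (mul_outLaw_mul_likelihood hp hq s u)
    set t := ∑ u, q s u * ind (T * outLaw p q u < q s u) with ht
    set g : U → ℝ := fun u => r u * (1 - ind (T * outLaw p q u < q s u)) with hg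
    have hg0 : ∀ u, 0 ≤ g u := fun u =>
      mul_nonneg (hr0 u) (by linarith [ind_le_one (T * outLaw p q u < q s u)])
    have hgr : ∀ u, g u ≤ r u := fun u =>
      mul_le_of_le_one_right (hr0 u) (by linarith [ind_nonneg (T * outLaw p q u < q s u)])
    have hgT : ∀ u, g u ≤ T := by
      intro u
      by_cases h : T * outLaw p q u < q s u
      · simp only [hg, ind_of h]; linarith
      · refine (hgr u).trans ?_
        exact div_le_of_le_mul₀ (hP.1 u) hT (not_lt.mp h)
    have hm : ∑ u, outLaw p q u * g u = 1 - t := by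
      rw [ht, ← (hq s).2, ← Finset.sum_sub_distrib]
      refine Finset.sum_congr rfl fun u _ => ?_
      simp only [hg]
      linear_combination (1 - ind (T * outLaw p q u < q s u)) * hPr u
    have ht0 : 0 ≤ t := Finset.sum_nonneg fun u _ => mul_nonneg ((hq s).1 u) (ind_nonneg _)
    have ht1 : t ≤ 1 := by
      have : 0 ≤ ∑ u, outLaw p q u * g u :=
        Finset.sum_nonneg fun u _ => mul_nonneg (hP.1 u) (hg0 u)
      linarith
    have hvar : ∑ u, outLaw p q u * (g u - (1 - t)) ^ 2 ≤ T := by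
      have h1 : ∑ u, outLaw p q u * (g u - (1 - t)) ^ 2
          = ∑ u, outLaw p q u * (g u) ^ 2 - (1 - t) ^ 2 := by
        have : ∀ u, outLaw p q u * (g u - (1 - t)) ^ 2 = outLaw p q u * (g u) ^ 2
            - 2 * (1 - t) * (outLaw p q u * g u) + (1 - t) ^ 2 * outLaw p q u := fun u => by ring
        simp_rw [this, Finset.sum_add_distrib, Finset.sum_sub_distrib, ← Finset.mul_sum, hm, hP.2]
        ring
      have h2 : ∑ u, outLaw p q u * (g u) ^ 2 ≤ ∑ u, T * (outLaw p q u * g u) := by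
        refine Finset.sum_le_sum fun u _ => ?_
        have := mul_le_mul_of_nonneg_right (hgT u) (mul_nonneg (hP.1 u) (hg0 u))
        nlinarith
      rw [← Finset.mul_sum, hm] at h2
      nlinarith [sq_nonneg (1 - t), mul_nonneg hT ht0]
    have hsq := sum_iid_sq (ι := ι) hP he (fun u => g u - (1 - t)) (by
      simp_rw [mul_sub, Finset.sum_sub_distrib, ← Finset.sum_mul, hm, hP.2]; ring)
    -- `t` is the loss of mean by truncation; deviation and loss must together exceed `L / 2`
    have hpt : ∀ c : ι → U, ind (∑ l, r (c (e l)) < L / 2)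
        ≤ 8 / L ^ 2 * (∑ l, (g (c (e l)) - (1 - t))) ^ 2 + 8 * t := by
      intro c
      by_cases h : ∑ l, r (c (e l)) < L / 2
      · rw [ind_of h]
        have h1 : ∑ l, g (c (e l)) ≤ ∑ l, r (c (e l)) := Finset.sum_le_sum fun l _ => hgr _
        have h2 : ∑ l, (g (c (e l)) - (1 - t)) = ∑ l, g (c (e l)) - L * (1 - t) := by
          rw [Finset.sum_sub_distrib]; simp [hLdef]; ring
        rw [h2]
        set G := ∑ l, g (c (e l))
        have h3 : L / 2 ≤ L - G := by linarith
        have h4 : L ^ 2 / 4 ≤ (L - G) ^ 2 := by nlinarith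
        have h5 : (L - G) ^ 2 ≤ 2 * (G - L * (1 - t)) ^ 2 + 2 * (L ^ 2 * t) := by
          nlinarith [sq_nonneg ((G - L * (1 - t)) + L * t), mul_nonneg (sq_nonneg L)
            (mul_nonneg ht0 (sub_nonneg.mpr ht1))]
        have h6 : 1 ≤ 4 / L ^ 2 * (2 * (G - L * (1 - t)) ^ 2 + 2 * (L ^ 2 * t)) := by
          rw [div_mul_eq_mul_div, le_div_iff₀ (by positivity)]
          linarith
        refine h6.trans (le_of_eq ?_)
        field_simp
        ring
      · rw [ind_of_not h]; positivity
    calc ∑ c : ι → U, (∏ k, outLaw p q (c k)) * ind (∑ l, r (c (e l)) < L / 2)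
        ≤ ∑ c : ι → U, (∏ k, outLaw p q (c k)) *
          (8 / L ^ 2 * (∑ l, (g (c (e l)) - (1 - t))) ^ 2 + 8 * t) :=
          Finset.sum_le_sum fun c _ => mul_le_mul_of_nonneg_left (hpt c) (hPi.1 c)
      _ = 8 / L ^ 2 * ∑ c : ι → U, (∏ k, outLaw p q (c k)) *
            (∑ l, (g (c (e l)) - (1 - t))) ^ 2 + 8 * t := by
          have hsplit : ∀ c : ι → U, (∏ k, outLaw p q (c k)) *
              (8 / L ^ 2 * (∑ l, (g (c (e l)) - (1 - t))) ^ 2 + 8 * t)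
              = 8 / L ^ 2 * ((∏ k, outLaw p q (c k)) * (∑ l, (g (c (e l)) - (1 - t))) ^ 2)
                + 8 * t * ∏ k, outLaw p q (c k) := fun c => by ring
          simp_rw [hsplit, Finset.sum_add_distrib, ← Finset.mul_sum]
          rw [show ∑ c : ι → U, ∏ k, outLaw p q (c k) = 1 from hPi.2, mul_one]
      _ ≤ 8 / L ^ 2 * (L * T) + 8 * t := by
          rw [hsq]
          gcongr
      _ = 8 * (T / L + t) := by field_simp
  refine (Finset.sum_le_sum fun s _ => key s).trans (le_of_eq ?_)
  have : ∀ s, p s * (8 * (T / L + ∑ u, q s u * ind (T * outLaw p q u < q s u)))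
      = 8 * (T / L) * p s + 8 * (p s * ∑ u, q s u * ind (T * outLaw p q u < q s u)) :=
    fun s => by ring
  simp_rw [this, Finset.sum_add_distrib, ← Finset.mul_sum, hp.2]
  ring

end Covering

/-- The law that is proportional to the nonnegative weights `r`; uniform if these all vanish. -/
noncomputable def normalized {κ : Type*} [Fintype κ] (r : κ → ℝ) (l : κ) : ℝ :=
  open Classical in if ∑ k, r k = 0 then 1 / Fintype.card κ else r l / ∑ k, r k

section Normalized

variable {κ : Type*} [Fintype κ] {r : κ → ℝ}

lemma normalized_mem_stdSimplex [Nonempty κ] (hr : ∀ l, 0 ≤ r l) :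
    normalized r ∈ stdSimplex ℝ κ := by
  unfold normalized
  split_ifs with h
  · refine ⟨fun l => by positivity, ?_⟩
    simp
  · exact ⟨fun l => div_nonneg (hr l) (Finset.sum_nonneg fun k _ => hr k), by
      rw [← Finset.sum_div, div_self h]⟩

lemma normalized_le [Nonempty κ] (hr : ∀ l, 0 ≤ r l) (l : κ)
    (h : (Fintype.card κ : ℝ) / 2 ≤ ∑ k, r k) :
    normalized r l ≤ 2 / Fintype.card κ * r l := by
  have hL : (0 : ℝ) < Fintype.card κ := by exact_mod_cast Fintype.card_pos
  have h0 : 0 < ∑ k, r k := by linarith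
  unfold normalized
  rw [if_neg h0.ne', div_le_iff₀ h0]
  have h1 : 2 / (Fintype.card κ : ℝ) * (Fintype.card κ / 2) = 1 := by field_simp
  calc r l = r l * (2 / (Fintype.card κ : ℝ) * (Fintype.card κ / 2)) := by rw [h1, mul_one]
    _ ≤ r l * (2 / (Fintype.card κ : ℝ) * ∑ k, r k) := by
      have := hr l
      gcongr
    _ = _ := by ring

end Normalized

/-! ### Joint decoding with independent codebooks -/

/-- The joint threshold decoder.  It returns the message of some codeword `c (w, l)` that passes the
test `A` together with the output `y` and some codeword `d j` of the other user. -/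
noncomputable def jointDecoder {M : ℕ} {κ J U V Y : Type*} (w₀ : Fin M) (A : U → V → Y → Prop)
    (c : Fin M × κ → U) (d : J → V) (y : Y) : Fin M :=
  open Classical in
  if h : ∃ w, ∃ l j, A (c (w, l)) (d j) y then h.choose else w₀

/-- A decoding error needs the transmitted codewords to fail the test or some codeword of a wrong
message to pass it.  Passing together with the transmitted codeword `d j` is counted apart, since this
one depends on `y`. -/
lemma ind_jointDecoder_ne_le {M : ℕ} {κ J U V Y : Type*} [Fintype κ] [Fintype J] [DecidableEq J]
    (w₀ : Fin M) (A : U → V → Y → Prop) (c : Fin M × κ → U) (d : J → V) (y : Y) (w : Fin M) (l : κ)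
    (j : J) :
    ind (jointDecoder w₀ A c d y ≠ w) ≤ ind (¬ A (c (w, l)) (d j) y) +
      ∑ i ∈ (Finset.univ.erase w) ×ˢ (Finset.univ : Finset κ),
        (ind (A (c i) (d j) y) + ∑ k ∈ Finset.univ.erase j, ind (A (c i) (d k) y)) := by
  classical
  have hnn : ∀ i ∈ (Finset.univ.erase w) ×ˢ (Finset.univ : Finset κ),
      0 ≤ ind (A (c i) (d j) y) + ∑ k ∈ Finset.univ.erase j, ind (A (c i) (d k) y) :=
    fun i _ => add_nonneg (ind_nonneg _) (Finset.sum_nonneg fun k _ => ind_nonneg _)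
  by_cases hA : A (c (w, l)) (d j) y
  · by_cases hw : jointDecoder w₀ A c d y = w
    · rw [ind_of_not (not_not.mpr hw)]
      exact add_nonneg (ind_nonneg _) (Finset.sum_nonneg hnn)
    · have hex : ∃ w, ∃ l j, A (c (w, l)) (d j) y := ⟨w, l, j, hA⟩
      have hdec : jointDecoder w₀ A c d y = hex.choose := dif_pos hex
      obtain ⟨l', j', h'⟩ := hex.choose_spec
      rw [← hdec] at h'
      set w' := jointDecoder w₀ A c d y
      rw [ind_of hw]
      have hmem : (w', l') ∈ (Finset.univ.erase w) ×ˢ (Finset.univ : Finset κ) := by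
        simp [hw]
      have h1 : 1 ≤ ind (A (c (w', l')) (d j) y)
          + ∑ k ∈ Finset.univ.erase j, ind (A (c (w', l')) (d k) y) := by
        by_cases hj : j' = j
        · subst hj
          rw [ind_of h']
          linarith [Finset.sum_nonneg fun k (_ : k ∈ Finset.univ.erase j') =>
            ind_nonneg (A (c (w', l')) (d k) y)]
        · have := Finset.single_le_sum (f := fun k => ind (A (c (w', l')) (d k) y))
            (fun k _ => ind_nonneg _) (Finset.mem_erase.mpr ⟨hj, Finset.mem_univ j'⟩)
          rw [ind_of h'] at this
          linarith [ind_nonneg (A (c (w', l')) (d j) y)]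
      have h2 := Finset.single_le_sum hnn hmem
      linarith [ind_nonneg (¬ A (c (w, l)) (d j) y)]
  · rw [ind_of hA]
    have := ind_le_one (jointDecoder w₀ A c d y ≠ w)
    linarith [Finset.sum_nonneg hnn]

lemma sum_mul_add_sum {X I J : Type*} [Fintype X] (w f : X → ℝ) (g : I → X → ℝ)
    (h : I → J → X → ℝ) (s : Finset I) (t : Finset J) :
    ∑ x, w x * (f x + ∑ i ∈ s, (g i x + ∑ j ∈ t, h i j x))
      = ∑ x, w x * f x + (∑ i ∈ s, ∑ x, w x * g i x + ∑ i ∈ s, ∑ j ∈ t, ∑ x, w x * h i j x) := by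
  simp_rw [mul_add, Finset.mul_sum, mul_add, Finset.sum_add_distrib, Finset.mul_sum]
  congr 1
  congr 1
  · exact Finset.sum_comm
  · rw [Finset.sum_comm]
    exact Finset.sum_congr rfl fun i _ => Finset.sum_comm

/-- The expectation of `f (S, U, V, Y)` when `S` has law `p`, `U` and `V` are drawn from `S` by
the kernels `q` and `q'`, and `Y` from `(S, U, V)` by the kernel `K`. -/
def jointExp {S U V Y : Type*} [Fintype S] [Fintype U] [Fintype V] [Fintype Y] (p : S → ℝ)
    (q : S → U → ℝ) (q' : S → V → ℝ) (K : S → U → V → Y → ℝ) (f : S → U → V → Y → ℝ) : ℝ :=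
  ∑ s, ∑ u, ∑ v, ∑ y, p s * q s u * q' s v * K s u v y * f s u v y

section Receiver

variable {S U V Y : Type*} [Fintype S] [Fintype U] [Fintype V]
  {p : S → ℝ} {q : S → U → ℝ} {q' : S → V → ℝ}

variable {I J : Type*} [Fintype I] [Fintype J]

/-- The weights of the idealized random experiment: i.i.d. codebooks `c`, `d`, and state `s` and
output `y` such that the codewords `c i` and `d j` are the transmitted ones. -/
noncomputable def idealWeight (p : S → ℝ) (q : S → U → ℝ) (q' : S → V → ℝ) (K : S → U → V → Y → ℝ)
    (i : I) (j : J) (x : (I → U) × (J → V) × S × Y) : ℝ :=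
  (∏ k, outLaw p q (x.1 k)) * (∏ k, outLaw p q' (x.2.1 k)) *
    (p x.2.2.1 * (likelihood p q x.2.2.1 (x.1 i) * likelihood p q' x.2.2.1 (x.2.1 j)) *
      K x.2.2.1 (x.1 i) (x.2.1 j) x.2.2.2)

lemma idealWeight_nonneg (hp : p ∈ stdSimplex ℝ S) (hq : ∀ s, q s ∈ stdSimplex ℝ U)
    (hq' : ∀ s, q' s ∈ stdSimplex ℝ V) {K : S → U → V → Y → ℝ} (hK : ∀ s u v y, 0 ≤ K s u v y)
    (i : I) (j : J) (x : (I → U) × (J → V) × S × Y) : 0 ≤ idealWeight p q q' K i j x :=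
  mul_nonneg (mul_nonneg (Finset.prod_nonneg fun _ _ => (outLaw_mem_stdSimplex hp hq).1 _)
    (Finset.prod_nonneg fun _ _ => (outLaw_mem_stdSimplex hp hq').1 _))
    (mul_nonneg (mul_nonneg (hp.1 _) (mul_nonneg (likelihood_nonneg hp hq _ _)
      (likelihood_nonneg hp hq' _ _))) (hK _ _ _ _))

variable [Fintype Y]

/-- Independent codewords, weighted with their likelihood ratios, have the joint law of
`jointExp`. -/
lemma sum_outLaw_likelihood (hp : p ∈ stdSimplex ℝ S) (hq : ∀ s, q s ∈ stdSimplex ℝ U)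
    (hq' : ∀ s, q' s ∈ stdSimplex ℝ V) (K f : S → U → V → Y → ℝ) :
    ∑ u, ∑ v, outLaw p q u * outLaw p q' v * (∑ s, ∑ y, p s *
        (likelihood p q s u * likelihood p q' s v) * K s u v y * f s u v y)
      = jointExp p q q' K f := by
  have h : ∀ s u v y, outLaw p q u * outLaw p q' v * (p s *
        (likelihood p q s u * likelihood p q' s v) * K s u v y * f s u v y)
      = p s * q s u * q' s v * K s u v y * f s u v y := by
    intro s u v y
    have h1 := mul_outLaw_mul_likelihood hp hq s u
    have h2 := mul_outLaw_mul_likelihood hp hq' s v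
    calc _ = (p s * (outLaw p q u * likelihood p q s u)) *
          (outLaw p q' v * likelihood p q' s v) * K s u v y * f s u v y := by ring
      _ = (p s * (outLaw p q' v * likelihood p q' s v)) * q s u * K s u v y * f s u v y := by
          rw [h1]; ring
      _ = _ := by rw [h2]; ring
  simp_rw [Finset.mul_sum, h]
  unfold jointExp
  rw [Finset.sum_congr rfl fun u _ => Finset.sum_comm, Finset.sum_comm]

variable [DecidableEq I] [DecidableEq J]

lemma sum_idealWeight_mul (K : S → U → V → Y → ℝ) (i : I) (j : J)
    (f : (I → U) → (J → V) → S → Y → ℝ) :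
    ∑ x, idealWeight p q q' K i j x * f x.1 x.2.1 x.2.2.1 x.2.2.2
      = ∑ c : I → U, (∏ k, outLaw p q (c k)) * ∑ d : J → V, (∏ k, outLaw p q' (d k)) *
          ∑ s, ∑ y, p s * (likelihood p q s (c i) * likelihood p q' s (d j)) *
            K s (c i) (d j) y * f c d s y := by
  simp only [Fintype.sum_prod_type, idealWeight, Finset.mul_sum]
  refine Finset.sum_congr rfl fun c _ => Finset.sum_congr rfl fun d _ =>
    Finset.sum_congr rfl fun s _ => Finset.sum_congr rfl fun y _ => ?_
  ring

/-- In the idealized experiment the transmitted codewords and the output have the joint law of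
`jointExp`. -/
lemma sum_idealWeight_true (hp : p ∈ stdSimplex ℝ S) (hq : ∀ s, q s ∈ stdSimplex ℝ U)
    (hq' : ∀ s, q' s ∈ stdSimplex ℝ V) (K : S → U → V → Y → ℝ) (i : I) (j : J)
    (f : U → V → Y → ℝ) :
    ∑ x, idealWeight p q q' K i j x * f (x.1 i) (x.2.1 j) x.2.2.2
      = jointExp p q q' K (fun _ u v y => f u v y) := by
  rw [sum_idealWeight_mul K i j fun c d _ y => f (c i) (d j) y]
  rw [← sum_outLaw_likelihood hp hq hq' K]
  rw [Finset.sum_congr rfl fun c _ => congrArg ((∏ k, outLaw p q (c k)) * ·)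
    (sum_iid_apply (outLaw_mem_stdSimplex hp hq') j fun v => ∑ s, ∑ y, p s *
      (likelihood p q s (c i) * likelihood p q' s v) * K s (c i) v y * f (c i) v y)]
  rw [sum_iid_apply (outLaw_mem_stdSimplex hp hq) i fun u => ∑ v, outLaw p q' v * ∑ s, ∑ y, p s *
      (likelihood p q s u * likelihood p q' s v) * K s u v y * f u v y]
  simp_rw [Finset.mul_sum, mul_assoc]

/-- A wrong codeword of the first user is independent of the transmitted codeword of the second user
and of the output. -/
lemma sum_idealWeight_wrong (hp : p ∈ stdSimplex ℝ S) (hq : ∀ s, q s ∈ stdSimplex ℝ U)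
    (hq' : ∀ s, q' s ∈ stdSimplex ℝ V) (K : S → U → V → Y → ℝ) {i i' : I} (hi : i ≠ i') (j : J)
    (f : U → V → Y → ℝ) :
    ∑ x, idealWeight p q q' K i j x * f (x.1 i') (x.2.1 j) x.2.2.2
      = ∑ u', outLaw p q u' * jointExp p q q' K (fun _ _ v y => f u' v y) := by
  rw [sum_idealWeight_mul K i j fun c d _ y => f (c i') (d j) y]
  simp_rw [← sum_outLaw_likelihood hp hq hq' K]
  rw [Finset.sum_congr rfl fun c _ => congrArg ((∏ k, outLaw p q (c k)) * ·)
    (sum_iid_apply (outLaw_mem_stdSimplex hp hq') j fun v => ∑ s, ∑ y, p s *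
      (likelihood p q s (c i) * likelihood p q' s v) * K s (c i) v y * f (c i') v y)]
  rw [sum_iid_apply₂ (outLaw_mem_stdSimplex hp hq) hi fun u u' => ∑ v, outLaw p q' v *
      ∑ s, ∑ y, p s * (likelihood p q s u * likelihood p q' s v) * K s u v y * f u' v y]
  rw [Finset.sum_comm]
  refine Finset.sum_congr rfl fun u' _ => ?_
  rw [Finset.mul_sum]
  refine Finset.sum_congr rfl fun u _ => ?_
  rw [Finset.mul_sum, Finset.mul_sum]
  exact Finset.sum_congr rfl fun v _ => by ring

/-- A pair of wrong codewords is independent of the output. -/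
lemma sum_idealWeight_wrong₂ (hp : p ∈ stdSimplex ℝ S) (hq : ∀ s, q s ∈ stdSimplex ℝ U)
    (hq' : ∀ s, q' s ∈ stdSimplex ℝ V) (K : S → U → V → Y → ℝ) {i i' : I} (hi : i ≠ i') {j j' : J}
    (hj : j ≠ j') (f : U → V → Y → ℝ) :
    ∑ x, idealWeight p q q' K i j x * f (x.1 i') (x.2.1 j') x.2.2.2
      = ∑ u', ∑ v', outLaw p q u' * outLaw p q' v' *
          jointExp p q q' K (fun _ _ _ y => f u' v' y) := by
  rw [sum_idealWeight_mul K i j fun c d _ y => f (c i') (d j') y]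
  simp_rw [← sum_outLaw_likelihood hp hq hq' K]
  rw [Finset.sum_congr rfl fun c _ => congrArg ((∏ k, outLaw p q (c k)) * ·)
    (sum_iid_apply₂ (outLaw_mem_stdSimplex hp hq') hj fun v v' => ∑ s, ∑ y, p s *
      (likelihood p q s (c i) * likelihood p q' s v) * K s (c i) v y * f (c i') v' y)]
  rw [sum_iid_apply₂ (outLaw_mem_stdSimplex hp hq) hi fun u u' => ∑ v, ∑ v', outLaw p q' v *
      outLaw p q' v' * ∑ s, ∑ y, p s * (likelihood p q s u * likelihood p q' s v) *
        K s u v y * f u' v' y]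
  rw [Finset.sum_comm]
  refine Finset.sum_congr rfl fun u' _ => ?_
  simp_rw [Finset.mul_sum (s := (Finset.univ : Finset V))]
  rw [Finset.sum_congr rfl fun u _ => Finset.sum_comm, Finset.sum_comm]
  refine Finset.sum_congr rfl fun v' _ => ?_
  rw [Finset.mul_sum]
  refine Finset.sum_congr rfl fun u _ => ?_
  rw [Finset.mul_sum]
  exact Finset.sum_congr rfl fun v _ => by ring

/-- A bound for the error probability of one receiver with the test `A`: the transmitted pair fails
the test, or a codeword of a wrong message passes it, together with the transmitted codeword of the
other user or with another one. -/
noncomputable def receiverBound (p : S → ℝ) (q : S → U → ℝ) (q' : S → V → ℝ)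
    (K : S → U → V → Y → ℝ) (A : U → V → Y → Prop) (a b : ℝ) : ℝ :=
  jointExp p q q' K (fun _ u v y => ind (¬ A u v y)) +
    a * ∑ u', outLaw p q u' * jointExp p q q' K (fun _ _ v y => ind (A u' v y)) +
    b * ∑ u', ∑ v', outLaw p q u' * outLaw p q' v' *
      jointExp p q q' K (fun _ _ _ y => ind (A u' v' y))

lemma jointExp_nonneg (hp : p ∈ stdSimplex ℝ S) (hq : ∀ s, q s ∈ stdSimplex ℝ U)
    (hq' : ∀ s, q' s ∈ stdSimplex ℝ V) {K : S → U → V → Y → ℝ} (hK : ∀ s u v y, 0 ≤ K s u v y)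
    {f : S → U → V → Y → ℝ} (hf : ∀ s u v y, 0 ≤ f s u v y) : 0 ≤ jointExp p q q' K f :=
  Finset.sum_nonneg fun s _ => Finset.sum_nonneg fun u _ => Finset.sum_nonneg fun v _ =>
    Finset.sum_nonneg fun y _ => mul_nonneg (mul_nonneg (mul_nonneg (mul_nonneg (hp.1 s)
      ((hq s).1 u)) ((hq' s).1 v)) (hK s u v y)) (hf s u v y)

/-- The union bound for the error probability of a receiver in the idealized experiment. -/
lemma sum_idealWeight_decoding_error {M : ℕ} {κ : Type*} [Fintype κ] [DecidableEq κ]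
    (hp : p ∈ stdSimplex ℝ S)
    (hq : ∀ s, q s ∈ stdSimplex ℝ U) (hq' : ∀ s, q' s ∈ stdSimplex ℝ V) {K : S → U → V → Y → ℝ}
    (hK : ∀ s u v y, 0 ≤ K s u v y) (A : U → V → Y → Prop) (w₀ w : Fin M) (l : κ) (j : J) :
    ∑ x : (Fin M × κ → U) × (J → V) × S × Y, idealWeight p q q' K (w, l) j x *
        ind (jointDecoder w₀ A x.1 x.2.1 x.2.2.2 ≠ w)
      ≤ receiverBound p q q' K A (((M : ℝ) - 1) * Fintype.card κ)
          (((M : ℝ) - 1) * Fintype.card κ * Fintype.card J) := by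
  have hP := outLaw_mem_stdSimplex hp hq
  have hP' := outLaw_mem_stdSimplex hp hq'
  refine (Finset.sum_le_sum fun x _ => mul_le_mul_of_nonneg_left
    (ind_jointDecoder_ne_le w₀ A x.1 x.2.1 x.2.2.2 w l j)
    (idealWeight_nonneg hp hq hq' hK (w, l) j x)).trans ?_
  rw [sum_mul_add_sum, sum_idealWeight_true hp hq hq' K (w, l) j fun u v y => ind (¬ A u v y)]
  unfold receiverBound
  rw [add_assoc]
  refine add_le_add le_rfl ?_
  have hM : 1 ≤ M := by have := w.2; omega
  have hcard : (((Finset.univ.erase w) ×ˢ (Finset.univ : Finset κ)).card : ℝ)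
      = ((M : ℝ) - 1) * Fintype.card κ := by
    rw [Finset.card_product, Finset.card_erase_of_mem (Finset.mem_univ w), Finset.card_univ,
      Finset.card_univ, Fintype.card_fin, Nat.cast_mul, Nat.cast_sub hM, Nat.cast_one]
  have hne : ∀ i ∈ (Finset.univ.erase w) ×ˢ (Finset.univ : Finset κ), (w, l) ≠ i := by
    rintro i hi rfl
    simp at hi
  refine add_le_add (le_of_eq ?_) ?_
  · rw [Finset.sum_congr rfl fun i hi => sum_idealWeight_wrong hp hq hq' K (hne i hi) j
      fun u v y => ind (A u v y), Finset.sum_const, nsmul_eq_mul, hcard]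
  · rw [Finset.sum_congr rfl fun i hi => Finset.sum_congr rfl fun k hk =>
      sum_idealWeight_wrong₂ hp hq hq' K (hne i hi) (Finset.ne_of_mem_erase hk).symm
        fun u v y => ind (A u v y)]
    rw [Finset.sum_const, Finset.sum_const, nsmul_eq_mul, nsmul_eq_mul, hcard, mul_assoc,
      mul_assoc, mul_assoc]
    have hM' : (0 : ℝ) ≤ (M : ℝ) - 1 := by
      rw [sub_nonneg]; exact_mod_cast hM
    refine mul_le_mul_of_nonneg_left (mul_le_mul_of_nonneg_left
      (mul_le_mul_of_nonneg_right ?_ ?_) (Nat.cast_nonneg _)) hM'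
    · exact_mod_cast Finset.card_le_univ _
    · exact Finset.sum_nonneg fun u _ => Finset.sum_nonneg fun v _ => mul_nonneg
        (mul_nonneg (hP.1 u) (hP'.1 v)) (jointExp_nonneg hp hq hq' hK fun _ _ _ _ => ind_nonneg _)

end Receiver

/-! ### The one-shot random coding bound -/

lemma exists_le_sum_mul {X : Type*} [Fintype X] {p : X → ℝ} (hp : p ∈ stdSimplex ℝ X) (g : X → ℝ) :
    ∃ x, g x ≤ ∑ x, p x * g x := by
  have hne : Nonempty X := by
    by_contra h
    rw [not_nonempty_iff] at h
    simpa using hp.2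
  obtain ⟨x₀, hx₀⟩ := Finite.exists_min g
  refine ⟨x₀, ?_⟩
  calc g x₀ = ∑ x, p x * g x₀ := by rw [← Finset.sum_mul, hp.2, one_mul]
    _ ≤ _ := Finset.sum_le_sum fun x _ => mul_le_mul_of_nonneg_left (hx₀ x) (hp.1 x)

lemma exists_fun_sum_le {I X : Type*} [Fintype I] [Fintype X] {E : I → X → ℝ}
    (hE : ∀ i, E i ∈ stdSimplex ℝ X) (g : I → X → ℝ) :
    ∃ f : I → X, ∑ i, g i (f i) ≤ ∑ i, ∑ x, E i x * g i x := by
  choose f hf using fun i => exists_le_sum_mul (hE i) (g i)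
  exact ⟨f, Finset.sum_le_sum fun i _ => hf i⟩

/-- Two randomized encoders that act independently given the state can be replaced by deterministic
ones, one after the other, without increasing the total cost `h`. -/
lemma exists_encoders_le {I J S X₁ X₂ : Type*} [Fintype I] [Fintype J] [Fintype S] [Fintype X₁]
    [Fintype X₂] {E₁ : I → S → X₁ → ℝ} {E₂ : J → S → X₂ → ℝ} (hE₁ : ∀ i s, E₁ i s ∈ stdSimplex ℝ X₁)
    (hE₂ : ∀ j s, E₂ j s ∈ stdSimplex ℝ X₂) (h : I → J → S → X₁ → X₂ → ℝ) :
    ∃ (e₁ : I → S → X₁) (e₂ : J → S → X₂), ∑ i, ∑ j, ∑ s, h i j s (e₁ i s) (e₂ j s)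
      ≤ ∑ i, ∑ j, ∑ s, ∑ x₁, ∑ x₂, E₁ i s x₁ * E₂ j s x₂ * h i j s x₁ x₂ := by
  obtain ⟨e₁, he₁⟩ := exists_fun_sum_le (I := I × S) (E := fun k => E₁ k.1 k.2)
    (fun k => hE₁ k.1 k.2) fun k x₁ => ∑ j, ∑ x₂, E₂ j k.2 x₂ * h k.1 j k.2 x₁ x₂
  obtain ⟨e₂, he₂⟩ := exists_fun_sum_le (I := J × S) (E := fun k => E₂ k.1 k.2)
    (fun k => hE₂ k.1 k.2) fun k x₂ => ∑ i, h i k.1 k.2 (e₁ (i, k.2)) x₂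
  refine ⟨fun i s => e₁ (i, s), fun j s => e₂ (j, s), ?_⟩
  simp only [Fintype.sum_prod_type, Finset.mul_sum] at he₁ he₂
  calc _ = ∑ j, ∑ s, ∑ i, h i j s (e₁ (i, s)) (e₂ (j, s)) := by
        rw [Finset.sum_comm]
        exact Finset.sum_congr rfl fun j _ => Finset.sum_comm
    _ ≤ _ := he₂
    _ = ∑ i, ∑ s, ∑ j, ∑ x₂, E₂ j s x₂ * h i j s (e₁ (i, s)) x₂ := by
        rw [Finset.sum_congr rfl fun j _ => Finset.sum_congr rfl fun s _ => Finset.sum_comm,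
          Finset.sum_congr rfl fun j _ => Finset.sum_comm, Finset.sum_comm,
          Finset.sum_congr rfl fun i _ => Finset.sum_comm]
    _ ≤ _ := he₁
    _ = _ := by
        refine Finset.sum_congr rfl fun i _ => ?_
        rw [Finset.sum_congr rfl fun s _ => Finset.sum_comm, Finset.sum_comm]
        exact Finset.sum_congr rfl fun j _ => Finset.sum_congr rfl fun s _ =>
          Finset.sum_congr rfl fun x₁ _ => Finset.sum_congr rfl fun x₂ _ => by ring

section ChangeOfMeasure

variable {S U V I J κ κ' : Type*} [Fintype S] [Fintype U] [Fintype V] [Fintype I] [DecidableEq I]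
  [Fintype J] [DecidableEq J] [Fintype κ] [Nonempty κ] [Fintype κ'] [Nonempty κ']
  {p : S → ℝ} {q : S → U → ℝ} {q' : S → V → ℝ}

/-- The probability that the total likelihood of `L` codewords is atypically small is at most this
number, by `covering_bound`. -/
noncomputable def coveringBound (p : S → ℝ) (q : S → U → ℝ) (T L : ℝ) : ℝ :=
  8 * (T / L + ∑ s, p s * ∑ u, q s u * ind (T * outLaw p q u < q s u))

/-- For one pair of codebooks and one state: the selection probabilities of both likelihood encoders
are at most twice the normalized likelihood ratios, unless a total likelihood is small. -/
lemma sum_normalized_le {r : κ → ℝ} {r' : κ' → ℝ} (hr : ∀ l, 0 ≤ r l) (hr' : ∀ l, 0 ≤ r' l)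
    {G : κ → κ' → ℝ} (hG0 : ∀ l l', 0 ≤ G l l') (hG1 : ∀ l l', G l l' ≤ 1) :
    ∑ l, ∑ l', normalized r l * normalized r' l' * G l l'
      ≤ 4 / (Fintype.card κ * Fintype.card κ') * ∑ l, ∑ l', r l * r' l' * G l l'
        + ind (∑ l, r l < (Fintype.card κ : ℝ) / 2) + ind (∑ l, r' l < (Fintype.card κ' : ℝ) / 2) := by
  have hn := normalized_mem_stdSimplex hr
  have hn' := normalized_mem_stdSimplex hr'
  have hnn : 0 ≤ 4 / ((Fintype.card κ : ℝ) * Fintype.card κ') * ∑ l, ∑ l', r l * r' l' * G l l' :=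
    mul_nonneg (by positivity) (Finset.sum_nonneg fun l _ => Finset.sum_nonneg fun l' _ =>
      mul_nonneg (mul_nonneg (hr l) (hr' l')) (hG0 l l'))
  have hone : ∑ l, ∑ l', normalized r l * normalized r' l' * G l l' ≤ 1 := by
    calc _ ≤ ∑ l, ∑ l', normalized r l * normalized r' l' :=
          Finset.sum_le_sum fun l _ => Finset.sum_le_sum fun l' _ =>
            mul_le_of_le_one_right (mul_nonneg (hn.1 l) (hn'.1 l')) (hG1 l l')
      _ = 1 := by simp_rw [← Finset.mul_sum, hn'.2, mul_one, hn.2]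
  by_cases h : ∑ l, r l < (Fintype.card κ : ℝ) / 2
  · rw [ind_of h]
    linarith [ind_nonneg (∑ l, r' l < (Fintype.card κ' : ℝ) / 2)]
  by_cases h' : ∑ l, r' l < (Fintype.card κ' : ℝ) / 2
  · rw [ind_of h']
    linarith [ind_nonneg (∑ l, r l < (Fintype.card κ : ℝ) / 2)]
  rw [ind_of_not h, ind_of_not h', add_zero, add_zero]
  simp_rw [Finset.mul_sum]
  refine Finset.sum_le_sum fun l _ => Finset.sum_le_sum fun l' _ => ?_
  calc normalized r l * normalized r' l' * G l l'
      ≤ (2 / Fintype.card κ * r l) * (2 / Fintype.card κ' * r' l') * G l l' :=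
        mul_le_mul_of_nonneg_right (mul_le_mul (normalized_le hr l (not_lt.mp h))
          (normalized_le hr' l' (not_lt.mp h')) (hn'.1 l')
          (mul_nonneg (by positivity) (hr l))) (hG0 l l')
    _ = _ := by ring

/-- Change of measure from likelihood encoding to the idealized experiment, in which the pair of
transmitted codewords has the exact joint law with the state. -/
lemma sum_likelihood_encoder_le (hp : p ∈ stdSimplex ℝ S) (hq : ∀ s, q s ∈ stdSimplex ℝ U)
    (hq' : ∀ s, q' s ∈ stdSimplex ℝ V) {e : κ → I} (he : Function.Injective e) {e' : κ' → J}
    (he' : Function.Injective e') {T T' : ℝ} (hT : 0 ≤ T) (hT' : 0 ≤ T')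
    {G : (I → U) → (J → V) → S → U → V → ℝ} (hG0 : ∀ c d s u v, 0 ≤ G c d s u v)
    (hG1 : ∀ c d s u v, G c d s u v ≤ 1) {B : ℝ}
    (hB : ∀ l l', ∑ c : I → U, (∏ k, outLaw p q (c k)) * ∑ d : J → V, (∏ k, outLaw p q' (d k)) *
      ∑ s, p s * (likelihood p q s (c (e l)) * likelihood p q' s (d (e' l'))) *
        G c d s (c (e l)) (d (e' l')) ≤ B) :
    ∑ c : I → U, (∏ k, outLaw p q (c k)) * ∑ d : J → V, (∏ k, outLaw p q' (d k)) *
      ∑ s, p s * ∑ l, ∑ l', normalized (fun l => likelihood p q s (c (e l))) l *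
        normalized (fun l' => likelihood p q' s (d (e' l'))) l' * G c d s (c (e l)) (d (e' l'))
      ≤ 4 * B + coveringBound p q T (Fintype.card κ) + coveringBound p q' T' (Fintype.card κ') := by
  have hP := iid_mem_stdSimplex (ι := I) (outLaw_mem_stdSimplex hp hq)
  have hP' := iid_mem_stdSimplex (ι := J) (outLaw_mem_stdSimplex hp hq')
  set L : ℝ := (Fintype.card κ : ℝ) with hL
  set L' : ℝ := (Fintype.card κ' : ℝ) with hL'
  have hL0 : 0 < L := by rw [hL]; exact_mod_cast Fintype.card_pos
  have hL0' : 0 < L' := by rw [hL']; exact_mod_cast Fintype.card_pos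
  set b : (I → U) → S → ℝ := fun c s => ind (∑ l, likelihood p q s (c (e l)) < L / 2) with hb
  set b' : (J → V) → S → ℝ := fun d s => ind (∑ l, likelihood p q' s (d (e' l)) < L' / 2) with hb'
  have hcov := covering_bound (e := e) hp hq he hT
  have hcov' := covering_bound (e := e') hp hq' he' hT'
  calc _ ≤ ∑ c : I → U, (∏ k, outLaw p q (c k)) * ∑ d : J → V, (∏ k, outLaw p q' (d k)) *
          ∑ s, p s * (4 / (L * L') * (∑ l, ∑ l', likelihood p q s (c (e l)) *
            likelihood p q' s (d (e' l')) * G c d s (c (e l)) (d (e' l'))) + b c s + b' d s) :=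
        Finset.sum_le_sum fun c _ => mul_le_mul_of_nonneg_left (Finset.sum_le_sum fun d _ =>
          mul_le_mul_of_nonneg_left (Finset.sum_le_sum fun s _ => mul_le_mul_of_nonneg_left
            (sum_normalized_le (fun l => likelihood_nonneg hp hq _ _)
              (fun l => likelihood_nonneg hp hq' _ _) (fun l l' => hG0 _ _ _ _ _)
              (fun l l' => hG1 _ _ _ _ _)) (hp.1 s)) (hP'.1 d)) (hP.1 c)
    _ = 4 / (L * L') * (∑ l, ∑ l', ∑ c : I → U, (∏ k, outLaw p q (c k)) * ∑ d : J → V,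
          (∏ k, outLaw p q' (d k)) * ∑ s, p s * (likelihood p q s (c (e l)) *
            likelihood p q' s (d (e' l'))) * G c d s (c (e l)) (d (e' l')))
        + ∑ s, p s * ∑ c : I → U, (∏ k, outLaw p q (c k)) * b c s
        + ∑ s, p s * ∑ d : J → V, (∏ k, outLaw p q' (d k)) * b' d s := by
      have h1 : ∑ c : I → U, (∏ k, outLaw p q (c k)) * ∑ d : J → V, (∏ k, outLaw p q' (d k)) *
          ∑ s, p s * b c s = ∑ s, p s * ∑ c : I → U, (∏ k, outLaw p q (c k)) * b c s := by
        simp_rw [← Finset.sum_mul]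
        rw [show ∑ d : J → V, ∏ k, outLaw p q' (d k) = 1 from hP'.2]
        simp_rw [one_mul, Finset.mul_sum]
        rw [Finset.sum_comm]
        exact Finset.sum_congr rfl fun s _ => Finset.sum_congr rfl fun c _ => by ring
      have h2 : ∑ c : I → U, (∏ k, outLaw p q (c k)) * ∑ d : J → V, (∏ k, outLaw p q' (d k)) *
          ∑ s, p s * b' d s = ∑ s, p s * ∑ d : J → V, (∏ k, outLaw p q' (d k)) * b' d s := by
        rw [← Finset.sum_mul, show ∑ c : I → U, ∏ k, outLaw p q (c k) = 1 from hP.2, one_mul]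
        simp_rw [Finset.mul_sum]
        rw [Finset.sum_comm]
        exact Finset.sum_congr rfl fun s _ => Finset.sum_congr rfl fun c _ => by ring
      have h3 : ∑ c : I → U, (∏ k, outLaw p q (c k)) * ∑ d : J → V, (∏ k, outLaw p q' (d k)) *
          ∑ s, p s * (4 / (L * L') * (∑ l, ∑ l', likelihood p q s (c (e l)) *
            likelihood p q' s (d (e' l')) * G c d s (c (e l)) (d (e' l'))))
          = 4 / (L * L') * (∑ l, ∑ l', ∑ c : I → U, (∏ k, outLaw p q (c k)) * ∑ d : J → V,
          (∏ k, outLaw p q' (d k)) * ∑ s, p s * (likelihood p q s (c (e l)) *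
            likelihood p q' s (d (e' l'))) * G c d s (c (e l)) (d (e' l'))) := by
        rw [Finset.sum_congr rfl fun l _ => Finset.sum_comm, Finset.sum_comm]
        rw [Finset.mul_sum]
        refine Finset.sum_congr rfl fun c _ => ?_
        simp_rw [← Finset.mul_sum]
        rw [mul_left_comm]
        congr 1
        rw [Finset.sum_congr rfl fun l _ => Finset.sum_comm, Finset.sum_comm, Finset.mul_sum]
        refine Finset.sum_congr rfl fun d _ => ?_
        simp_rw [← Finset.mul_sum]
        rw [mul_left_comm]
        congr 1
        rw [Finset.sum_congr rfl fun l _ => Finset.sum_comm, Finset.sum_comm, Finset.mul_sum]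
        refine Finset.sum_congr rfl fun s _ => ?_
        simp_rw [Finset.mul_sum]
        exact Finset.sum_congr rfl fun l _ => Finset.sum_congr rfl fun l' _ => by ring
      rw [← h1, ← h2, ← h3]
      simp_rw [mul_add, Finset.sum_add_distrib, mul_add, Finset.sum_add_distrib, mul_add,
        Finset.sum_add_distrib]
    _ ≤ 4 / (L * L') * (∑ _l : κ, ∑ _l' : κ', B) + coveringBound p q T L
          + coveringBound p q' T' L' := by
      refine add_le_add (add_le_add (mul_le_mul_of_nonneg_left ?_ (by positivity)) hcov) hcov'
      exact Finset.sum_le_sum fun l _ => Finset.sum_le_sum fun l' _ => hB l l'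
    _ = _ := by
      simp only [Finset.sum_const, Finset.card_univ, nsmul_eq_mul, ← hL, ← hL']
      field_simp

end ChangeOfMeasure

section OneShot

variable {S U V X₁ X₂ Y₁ Y₂ : Type*} [Fintype X₁] [Fintype X₂]

/-- The channel from the auxiliary letters `(u, v)` to the outputs, for which the channel inputs are
drawn by the kernels `k₁` and `k₂`. -/
def auxChannel (k₁ : U → S → X₁ → ℝ) (k₂ : V → S → X₂ → ℝ) (W : S → X₁ → X₂ → Y₁ → Y₂ → ℝ)
    (s : S) (u : U) (v : V) (y₁ : Y₁) (y₂ : Y₂) : ℝ :=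
  ∑ x₁, ∑ x₂, k₁ u s x₁ * k₂ v s x₂ * W s x₁ x₂ y₁ y₂

lemma auxChannel_nonneg {k₁ : U → S → X₁ → ℝ} {k₂ : V → S → X₂ → ℝ}
    {W : S → X₁ → X₂ → Y₁ → Y₂ → ℝ} (hk₁ : ∀ u s, k₁ u s ∈ stdSimplex ℝ X₁)
    (hk₂ : ∀ v s, k₂ v s ∈ stdSimplex ℝ X₂) (hW : ∀ s x₁ x₂ y₁ y₂, 0 ≤ W s x₁ x₂ y₁ y₂)
    (s : S) (u : U) (v : V) (y₁ : Y₁) (y₂ : Y₂) : 0 ≤ auxChannel k₁ k₂ W s u v y₁ y₂ :=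
  Finset.sum_nonneg fun x₁ _ => Finset.sum_nonneg fun x₂ _ =>
    mul_nonneg (mul_nonneg ((hk₁ u s).1 x₁) ((hk₂ v s).1 x₂)) (hW _ _ _ _ _)

variable [Fintype Y₁] [Fintype Y₂]

lemma sum_auxChannel {k₁ : U → S → X₁ → ℝ} {k₂ : V → S → X₂ → ℝ}
    {W : S → X₁ → X₂ → Y₁ → Y₂ → ℝ} (hk₁ : ∀ u s, k₁ u s ∈ stdSimplex ℝ X₁)
    (hk₂ : ∀ v s, k₂ v s ∈ stdSimplex ℝ X₂) (hW1 : ∀ s x₁ x₂, ∑ y₁, ∑ y₂, W s x₁ x₂ y₁ y₂ = 1)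
    (s : S) (u : U) (v : V) : ∑ y₁, ∑ y₂, auxChannel k₁ k₂ W s u v y₁ y₂ = 1 := by
  calc _ = ∑ x₁, ∑ x₂, k₁ u s x₁ * k₂ v s x₂ * ∑ y₁, ∑ y₂, W s x₁ x₂ y₁ y₂ := by
        unfold auxChannel
        simp_rw [Finset.mul_sum]
        rw [Finset.sum_congr rfl fun y₁ _ => Finset.sum_comm, Finset.sum_comm]
        refine Finset.sum_congr rfl fun x₁ _ => ?_
        rw [Finset.sum_congr rfl fun y₁ _ => Finset.sum_comm, Finset.sum_comm]
    _ = 1 := by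
        simp_rw [hW1, mul_one, ← Finset.mul_sum, (hk₂ v s).2, mul_one, (hk₁ u s).2]

variable [Fintype S] [Fintype U] [Fintype V]

/-- The error probability averaged over both random codebooks, for one pair of messages, when each
encoder `k` selects one of the `κₖ` codewords of its message by the likelihood rule. -/
lemma sum_codebooks_error_le {M₁ M₂ : ℕ} {κ₁ κ₂ : Type*} [Fintype κ₁] [DecidableEq κ₁] [Nonempty κ₁]
    [Fintype κ₂] [DecidableEq κ₂] [Nonempty κ₂]
    {p : S → ℝ} {q₁ : S → U → ℝ} {q₂ : S → V → ℝ} {K : S → U → V → Y₁ → Y₂ → ℝ}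
    (hp : p ∈ stdSimplex ℝ S) (hq₁ : ∀ s, q₁ s ∈ stdSimplex ℝ U) (hq₂ : ∀ s, q₂ s ∈ stdSimplex ℝ V)
    (hK : ∀ s u v y₁ y₂, 0 ≤ K s u v y₁ y₂) (hK1 : ∀ s u v, ∑ y₁, ∑ y₂, K s u v y₁ y₂ = 1)
    (A₁ : U → V → Y₁ → Prop) (A₂ : V → U → Y₂ → Prop) {T₁ T₂ : ℝ} (hT₁ : 0 ≤ T₁) (hT₂ : 0 ≤ T₂)
    (v₁ w₁ : Fin M₁) (v₂ w₂ : Fin M₂) :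
    ∑ c : Fin M₁ × κ₁ → U, (∏ k, outLaw p q₁ (c k)) *
      ∑ d : Fin M₂ × κ₂ → V, (∏ k, outLaw p q₂ (d k)) *
      ∑ s, p s * ∑ l, ∑ l', normalized (fun l => likelihood p q₁ s (c (w₁, l))) l *
        normalized (fun l' => likelihood p q₂ s (d (w₂, l'))) l' *
          ∑ y₁, ∑ y₂, K s (c (w₁, l)) (d (w₂, l')) y₁ y₂ *
            ind (jointDecoder v₁ A₁ c d y₁ ≠ w₁ ∨ jointDecoder v₂ A₂ d c y₂ ≠ w₂)
      ≤ 4 * (receiverBound p q₁ q₂ (fun s u v y₁ => ∑ y₂, K s u v y₁ y₂) A₁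
            (((M₁ : ℝ) - 1) * Fintype.card κ₁)
            (((M₁ : ℝ) - 1) * Fintype.card κ₁ * (M₂ * Fintype.card κ₂))
          + receiverBound p q₂ q₁ (fun s v u y₂ => ∑ y₁, K s u v y₁ y₂) A₂
            (((M₂ : ℝ) - 1) * Fintype.card κ₂)
            (((M₂ : ℝ) - 1) * Fintype.card κ₂ * (M₁ * Fintype.card κ₁)))
        + coveringBound p q₁ T₁ (Fintype.card κ₁) + coveringBound p q₂ T₂ (Fintype.card κ₂) := by
  have hP₁ := iid_mem_stdSimplex (ι := Fin M₁ × κ₁) (outLaw_mem_stdSimplex hp hq₁)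
  have hP₂ := iid_mem_stdSimplex (ι := Fin M₂ × κ₂) (outLaw_mem_stdSimplex hp hq₂)
  refine sum_likelihood_encoder_le (e := fun l => (w₁, l)) (e' := fun l => (w₂, l))
    (G := fun c d s u v => ∑ y₁, ∑ y₂, K s u v y₁ y₂ *
      ind (jointDecoder v₁ A₁ c d y₁ ≠ w₁ ∨ jointDecoder v₂ A₂ d c y₂ ≠ w₂))
    hp hq₁ hq₂ (Prod.mk_right_injective w₁) (Prod.mk_right_injective w₂) hT₁ hT₂ ?_ ?_ ?_
  · exact fun c d s u v => Finset.sum_nonneg fun y₁ _ => Finset.sum_nonneg fun y₂ _ =>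
      mul_nonneg (hK _ _ _ _ _) (ind_nonneg _)
  · intro c d s u v
    rw [← hK1 s u v]
    exact Finset.sum_le_sum fun y₁ _ => Finset.sum_le_sum fun y₂ _ =>
      mul_le_of_le_one_right (hK _ _ _ _ _) (ind_le_one _)
  · intro l l'
    have h1 := sum_idealWeight_decoding_error (J := Fin M₂ × κ₂) hp hq₁ hq₂
      (K := fun s u v y₁ => ∑ y₂, K s u v y₁ y₂)
      (fun s u v y₁ => Finset.sum_nonneg fun y₂ _ => hK s u v y₁ y₂) A₁ v₁ w₁ l (w₂, l')
    have h2 := sum_idealWeight_decoding_error (J := Fin M₁ × κ₁) hp hq₂ hq₁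
      (K := fun s v u y₂ => ∑ y₁, K s u v y₁ y₂)
      (fun s v u y₂ => Finset.sum_nonneg fun y₁ _ => hK s u v y₁ y₂) A₂ v₂ w₂ l' (w₁, l)
    rw [sum_idealWeight_mul _ _ _ fun c d _ y => ind (jointDecoder v₁ A₁ c d y ≠ w₁),
      Fintype.card_prod, Fintype.card_fin, Nat.cast_mul] at h1
    rw [sum_idealWeight_mul _ _ _ fun d c _ y => ind (jointDecoder v₂ A₂ d c y ≠ w₂),
      Fintype.card_prod, Fintype.card_fin, Nat.cast_mul] at h2
    refine le_trans (le_of_le_of_eq (b := ∑ c : Fin M₁ × κ₁ → U, (∏ k, outLaw p q₁ (c k)) *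
        ∑ d : Fin M₂ × κ₂ → V, (∏ k, outLaw p q₂ (d k)) *
        (∑ s, ∑ y₁, p s * (likelihood p q₁ s (c (w₁, l)) * likelihood p q₂ s (d (w₂, l'))) *
            (∑ y₂, K s (c (w₁, l)) (d (w₂, l')) y₁ y₂) * ind (jointDecoder v₁ A₁ c d y₁ ≠ w₁)
          + ∑ s, ∑ y₂, p s * (likelihood p q₂ s (d (w₂, l')) * likelihood p q₁ s (c (w₁, l))) *
            (∑ y₁, K s (c (w₁, l)) (d (w₂, l')) y₁ y₂) * ind (jointDecoder v₂ A₂ d c y₂ ≠ w₂))) ?_ ?_)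
      (add_le_add h1 h2)
    · refine Finset.sum_le_sum fun c _ => mul_le_mul_of_nonneg_left (Finset.sum_le_sum fun d _ =>
        mul_le_mul_of_nonneg_left ?_ (hP₂.1 d)) (hP₁.1 c)
      rw [← Finset.sum_add_distrib]
      refine Finset.sum_le_sum fun s _ => ?_
      set u := c (w₁, l)
      set v := d (w₂, l')
      have hr : 0 ≤ p s * (likelihood p q₁ s u * likelihood p q₂ s v) :=
        mul_nonneg (hp.1 s) (mul_nonneg (likelihood_nonneg hp hq₁ _ _)
          (likelihood_nonneg hp hq₂ _ _))
      have h3 : ∑ y₁, ∑ y₂, K s u v y₁ y₂ *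
            ind (jointDecoder v₁ A₁ c d y₁ ≠ w₁ ∨ jointDecoder v₂ A₂ d c y₂ ≠ w₂)
          ≤ ∑ y₁, (∑ y₂, K s u v y₁ y₂) * ind (jointDecoder v₁ A₁ c d y₁ ≠ w₁) +
            ∑ y₂, (∑ y₁, K s u v y₁ y₂) * ind (jointDecoder v₂ A₂ d c y₂ ≠ w₂) := by
        simp_rw [Finset.sum_mul]
        rw [Finset.sum_comm (f := fun y₂ y₁ => K s u v y₁ y₂ *
          ind (jointDecoder v₂ A₂ d c y₂ ≠ w₂)), ← Finset.sum_add_distrib]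
        refine Finset.sum_le_sum fun y₁ _ => ?_
        rw [← Finset.sum_add_distrib]
        refine Finset.sum_le_sum fun y₂ _ => ?_
        rw [← mul_add]
        exact mul_le_mul_of_nonneg_left (ind_or_le _ _) (hK _ _ _ _ _)
      refine (mul_le_mul_of_nonneg_left h3 hr).trans (le_of_eq ?_)
      rw [mul_add, Finset.mul_sum, Finset.mul_sum]
      congr 1
      · exact Finset.sum_congr rfl fun y₁ _ => by ring
      · exact Finset.sum_congr rfl fun y₂ _ => by ring
    · simp_rw [mul_add, Finset.sum_add_distrib, mul_add, Finset.sum_add_distrib]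
      congr 1
      simp_rw [Finset.mul_sum]
      rw [Finset.sum_comm]
      refine Finset.sum_congr rfl fun d _ => Finset.sum_congr rfl fun c _ =>
        Finset.sum_congr rfl fun s _ => Finset.sum_congr rfl fun y₂ _ => ?_
      ring

/-- The one-shot coding theorem: there are deterministic encoders that see the state, and decoders
that do not, whose average error probability obeys the random coding bound. -/
theorem exists_code_error_le {M₁ M₂ L₁ L₂ : ℕ} (hM₁ : 0 < M₁) (hM₂ : 0 < M₂) (hL₁ : 0 < L₁)
    (hL₂ : 0 < L₂) {p : S → ℝ} {q₁ : S → U → ℝ} {q₂ : S → V → ℝ} {k₁ : U → S → X₁ → ℝ}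
    {k₂ : V → S → X₂ → ℝ} {W : S → X₁ → X₂ → Y₁ → Y₂ → ℝ}
    (hp : p ∈ stdSimplex ℝ S) (hq₁ : ∀ s, q₁ s ∈ stdSimplex ℝ U) (hq₂ : ∀ s, q₂ s ∈ stdSimplex ℝ V)
    (hk₁ : ∀ u s, k₁ u s ∈ stdSimplex ℝ X₁) (hk₂ : ∀ v s, k₂ v s ∈ stdSimplex ℝ X₂)
    (hW : ∀ s x₁ x₂ y₁ y₂, 0 ≤ W s x₁ x₂ y₁ y₂) (hW1 : ∀ s x₁ x₂, ∑ y₁, ∑ y₂, W s x₁ x₂ y₁ y₂ = 1)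
    (A₁ : U → V → Y₁ → Prop) (A₂ : V → U → Y₂ → Prop) {T₁ T₂ : ℝ} (hT₁ : 0 ≤ T₁) (hT₂ : 0 ≤ T₂) :
    ∃ (e₁ : Fin M₁ → S → X₁) (e₂ : Fin M₂ → S → X₂) (d₁ : Y₁ → Fin M₁) (d₂ : Y₂ → Fin M₂),
      1 / ((M₁ : ℝ) * M₂) * ∑ w₁, ∑ w₂, ∑ s, p s * ∑ y₁, ∑ y₂,
          W s (e₁ w₁ s) (e₂ w₂ s) y₁ y₂ * ind (d₁ y₁ ≠ w₁ ∨ d₂ y₂ ≠ w₂)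
        ≤ 4 * (receiverBound p q₁ q₂ (fun s u v y₁ => ∑ y₂, auxChannel k₁ k₂ W s u v y₁ y₂) A₁
              (((M₁ : ℝ) - 1) * L₁) (((M₁ : ℝ) - 1) * L₁ * (M₂ * L₂))
            + receiverBound p q₂ q₁ (fun s v u y₂ => ∑ y₁, auxChannel k₁ k₂ W s u v y₁ y₂) A₂
              (((M₂ : ℝ) - 1) * L₂) (((M₂ : ℝ) - 1) * L₂ * (M₁ * L₁)))
          + coveringBound p q₁ T₁ L₁ + coveringBound p q₂ T₂ L₂ := by
  have : Nonempty (Fin L₁) := ⟨⟨0, hL₁⟩⟩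
  have : Nonempty (Fin L₂) := ⟨⟨0, hL₂⟩⟩
  set B := 4 * (receiverBound p q₁ q₂ (fun s u v y₁ => ∑ y₂, auxChannel k₁ k₂ W s u v y₁ y₂) A₁
              (((M₁ : ℝ) - 1) * L₁) (((M₁ : ℝ) - 1) * L₁ * (M₂ * L₂))
            + receiverBound p q₂ q₁ (fun s v u y₂ => ∑ y₁, auxChannel k₁ k₂ W s u v y₁ y₂) A₂
              (((M₂ : ℝ) - 1) * L₂) (((M₂ : ℝ) - 1) * L₂ * (M₁ * L₁)))
          + coveringBound p q₁ T₁ L₁ + coveringBound p q₂ T₂ L₂ with hB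
  set D₁ : (Fin M₁ × Fin L₁ → U) → (Fin M₂ × Fin L₂ → V) → Y₁ → Fin M₁ :=
    fun c d y₁ => jointDecoder ⟨0, hM₁⟩ A₁ c d y₁ with hD₁
  set D₂ : (Fin M₁ × Fin L₁ → U) → (Fin M₂ × Fin L₂ → V) → Y₂ → Fin M₂ :=
    fun c d y₂ => jointDecoder ⟨0, hM₂⟩ A₂ d c y₂ with hD₂
  set Err : (Fin M₁ × Fin L₁ → U) → (Fin M₂ × Fin L₂ → V) → Fin M₁ → Fin M₂ → ℝ :=
    fun c d w₁ w₂ => ∑ s, p s * ∑ l, ∑ l',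
      normalized (fun l => likelihood p q₁ s (c (w₁, l))) l *
      normalized (fun l' => likelihood p q₂ s (d (w₂, l'))) l' *
          ∑ y₁, ∑ y₂, auxChannel k₁ k₂ W s (c (w₁, l)) (d (w₂, l')) y₁ y₂ *
            ind (D₁ c d y₁ ≠ w₁ ∨ D₂ c d y₂ ≠ w₂) with hErr
  have hpair : ∀ w₁ w₂, ∑ c, (∏ k, outLaw p q₁ (c k)) * ∑ d, (∏ k, outLaw p q₂ (d k)) *
      Err c d w₁ w₂ ≤ B := by
    intro w₁ w₂
    have := sum_codebooks_error_le (κ₁ := Fin L₁) (κ₂ := Fin L₂) hp hq₁ hq₂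
      (auxChannel_nonneg hk₁ hk₂ hW) (sum_auxChannel hk₁ hk₂ hW1)
      A₁ A₂ hT₁ hT₂ ⟨0, hM₁⟩ w₁ ⟨0, hM₂⟩ w₂
    simpa only [Fintype.card_fin] using this
  have hP₁ := iid_mem_stdSimplex (ι := Fin M₁ × Fin L₁) (outLaw_mem_stdSimplex hp hq₁)
  have hP₂ := iid_mem_stdSimplex (ι := Fin M₂ × Fin L₂) (outLaw_mem_stdSimplex hp hq₂)
  obtain ⟨c, hc⟩ := exists_le_sum_mul hP₁ fun c => ∑ d, (∏ k, outLaw p q₂ (d k)) *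
    ∑ w₁, ∑ w₂, Err c d w₁ w₂
  obtain ⟨d, hd⟩ := exists_le_sum_mul hP₂ fun d => ∑ w₁, ∑ w₂, Err c d w₁ w₂
  have htot : ∑ w₁, ∑ w₂, Err c d w₁ w₂ ≤ M₁ * M₂ * B := by
    refine hd.trans (hc.trans ?_)
    calc _ = ∑ w₁, ∑ w₂, ∑ c, (∏ k, outLaw p q₁ (c k)) * ∑ d, (∏ k, outLaw p q₂ (d k)) *
            Err c d w₁ w₂ := by
          rw [Finset.sum_congr rfl fun w₁ _ => Finset.sum_comm, Finset.sum_comm]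
          refine Finset.sum_congr rfl fun c _ => ?_
          simp_rw [← Finset.mul_sum]
          congr 1
          rw [Finset.sum_congr rfl fun w₁ _ => Finset.sum_comm, Finset.sum_comm]
          refine Finset.sum_congr rfl fun d _ => ?_
          simp_rw [← Finset.mul_sum]
      _ ≤ ∑ _w₁ : Fin M₁, ∑ _w₂ : Fin M₂, B :=
          Finset.sum_le_sum fun w₁ _ => Finset.sum_le_sum fun w₂ _ => hpair w₁ w₂
      _ = _ := by simp; ring
  set E₁ : Fin M₁ → S → X₁ → ℝ := fun w s x => ∑ l,
    normalized (fun l => likelihood p q₁ s (c (w, l))) l * k₁ (c (w, l)) s x with hE₁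
  set E₂ : Fin M₂ → S → X₂ → ℝ := fun w s x => ∑ l,
    normalized (fun l => likelihood p q₂ s (d (w, l))) l * k₂ (d (w, l)) s x with hE₂
  have hE₁s : ∀ w s, E₁ w s ∈ stdSimplex ℝ X₁ := fun w s =>
    outLaw_mem_stdSimplex (normalized_mem_stdSimplex fun l => likelihood_nonneg hp hq₁ _ _)
      fun l => hk₁ (c (w, l)) s
  have hE₂s : ∀ w s, E₂ w s ∈ stdSimplex ℝ X₂ := fun w s =>
    outLaw_mem_stdSimplex (normalized_mem_stdSimplex fun l => likelihood_nonneg hp hq₂ _ _)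
      fun l => hk₂ (d (w, l)) s
  obtain ⟨e₁, e₂, he⟩ := exists_encoders_le hE₁s hE₂s fun w₁ w₂ s x₁ x₂ => p s * ∑ y₁, ∑ y₂,
    W s x₁ x₂ y₁ y₂ * ind (D₁ c d y₁ ≠ w₁ ∨ D₂ c d y₂ ≠ w₂)
  refine ⟨e₁, e₂, D₁ c d, D₂ c d, ?_⟩
  have hE : ∀ w₁ w₂, ∑ s, ∑ x₁, ∑ x₂, E₁ w₁ s x₁ * E₂ w₂ s x₂ * (p s * ∑ y₁, ∑ y₂,
      W s x₁ x₂ y₁ y₂ * ind (D₁ c d y₁ ≠ w₁ ∨ D₂ c d y₂ ≠ w₂)) = Err c d w₁ w₂ := by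
    intro w₁ w₂
    refine Finset.sum_congr rfl fun s _ => ?_
    set F : X₁ → X₂ → ℝ := fun x₁ x₂ => ∑ y₁, ∑ y₂, W s x₁ x₂ y₁ y₂ *
      ind (D₁ c d y₁ ≠ w₁ ∨ D₂ c d y₂ ≠ w₂) with hF
    have h1 : ∀ u v, ∑ y₁, ∑ y₂, auxChannel k₁ k₂ W s u v y₁ y₂ *
        ind (D₁ c d y₁ ≠ w₁ ∨ D₂ c d y₂ ≠ w₂) = ∑ x₁, ∑ x₂, k₁ u s x₁ * k₂ v s x₂ * F x₁ x₂ := by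
      intro u v
      simp only [hF, auxChannel, Finset.sum_mul, Finset.mul_sum]
      rw [Finset.sum_congr rfl fun y₁ _ => Finset.sum_comm, Finset.sum_comm]
      refine Finset.sum_congr rfl fun x₁ _ => ?_
      rw [Finset.sum_congr rfl fun y₁ _ => Finset.sum_comm, Finset.sum_comm]
      exact Finset.sum_congr rfl fun x₂ _ => Finset.sum_congr rfl fun y₁ _ =>
        Finset.sum_congr rfl fun y₂ _ => by ring
    simp_rw [h1]
    have h2 : ∀ x₁ x₂, E₁ w₁ s x₁ * E₂ w₂ s x₂ * (p s * F x₁ x₂) = ∑ l, ∑ l', p s *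
        (normalized (fun l => likelihood p q₁ s (c (w₁, l))) l *
          normalized (fun l' => likelihood p q₂ s (d (w₂, l'))) l' *
          (k₁ (c (w₁, l)) s x₁ * k₂ (d (w₂, l')) s x₂ * F x₁ x₂)) := by
      intro x₁ x₂
      simp only [hE₁, hE₂]
      rw [Finset.sum_mul_sum, Finset.sum_mul]
      refine Finset.sum_congr rfl fun l _ => ?_
      rw [Finset.sum_mul]
      exact Finset.sum_congr rfl fun l' _ => by ring
    change ∑ x₁, ∑ x₂, E₁ w₁ s x₁ * E₂ w₂ s x₂ * (p s * F x₁ x₂) = _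
    simp_rw [h2, Finset.mul_sum]
    rw [Finset.sum_congr rfl fun x₁ _ => Finset.sum_comm, Finset.sum_comm]
    refine Finset.sum_congr rfl fun l _ => ?_
    rw [Finset.sum_congr rfl fun x₁ _ => Finset.sum_comm, Finset.sum_comm]
  simp_rw [hE] at he
  have hpos : (0 : ℝ) < M₁ * M₂ := by positivity
  rw [one_div, inv_mul_le_iff₀ hpos]
  exact he.trans htot

end OneShot

/-! ### Laws of functions and mutual information -/

section PushLaw

variable {Ω α β : Type*} [Fintype Ω] [Fintype α] [Fintype β] {p : Ω → ℝ}

lemma sum_pushLaw_mul (p : Ω → ℝ) (g : Ω → α) (F : α → ℝ) :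
    ∑ a, pushLaw p g a * F a = ∑ ω, p ω * F (g ω) := by
  unfold pushLaw
  simp_rw [Finset.sum_mul]
  rw [Finset.sum_comm]
  refine Finset.sum_congr rfl fun ω _ => ?_
  rw [Finset.sum_eq_single (g ω)]
  · rw [ind_of rfl, mul_one]
  · intro a _ ha
    rw [ind_of_not (Ne.symm ha)]; ring
  · simp

lemma pushLaw_pushLaw {γ : Type*} (p : Ω → ℝ) (g : Ω → α) (h : α → γ) :
    pushLaw (pushLaw p g) h = pushLaw p (fun ω => h (g ω)) := by
  funext b
  exact sum_pushLaw_mul p g fun a => ind (h a = b)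

lemma pushLaw_id (p : Ω → ℝ) : pushLaw p (fun ω => ω) = p := by
  funext ω
  rw [pushLaw, Finset.sum_eq_single ω]
  · rw [ind_of rfl, mul_one]
  · intro t _ ht
    rw [ind_of_not ht, mul_zero]
  · simp

lemma pushLaw_mem_stdSimplex (hp : p ∈ stdSimplex ℝ Ω) (g : Ω → α) :
    pushLaw p g ∈ stdSimplex ℝ α := by
  refine ⟨fun a => Finset.sum_nonneg fun ω _ => mul_nonneg (hp.1 ω) (ind_nonneg _), ?_⟩
  have := sum_pushLaw_mul p g fun _ => 1
  simpa [hp.2] using this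

lemma pushLaw_pos {α : Type*} (hp : p ∈ stdSimplex ℝ Ω) (g : Ω → α) {ω : Ω} (h : 0 < p ω) :
    0 < pushLaw p g (g ω) := by
  refine h.trans_le ?_
  have := Finset.single_le_sum (f := fun ω' => p ω' * ind (g ω' = g ω))
    (fun ω' _ => mul_nonneg (hp.1 ω') (ind_nonneg _)) (Finset.mem_univ ω)
  simpa [pushLaw, ind_of] using this

/-- The mutual information, in bits, of `A` and `B` under the law `p` on a finite type. -/
noncomputable def finiteInfo (p : Ω → ℝ) (A : Ω → α) (B : Ω → β) : ℝ :=
  ∑ a, ∑ b, pushLaw p (fun ω => (A ω, B ω)) (a, b) *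
    Real.logb 2 (pushLaw p (fun ω => (A ω, B ω)) (a, b) / (pushLaw p A a * pushLaw p B b))

lemma finiteInfo_eq_sum (p : Ω → ℝ) (A : Ω → α) (B : Ω → β) :
    finiteInfo p A B = ∑ ω, p ω * Real.logb 2 (pushLaw p (fun ω => (A ω, B ω)) (A ω, B ω) /
      (pushLaw p A (A ω) * pushLaw p B (B ω))) := by
  unfold finiteInfo
  rw [← Fintype.sum_prod_type']
  exact sum_pushLaw_mul p (fun ω => (A ω, B ω)) fun c =>
    Real.logb 2 (pushLaw p (fun ω => (A ω, B ω)) c / (pushLaw p A c.1 * pushLaw p B c.2))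

/-- Gibbs' inequality for the mutual information. -/
lemma finiteInfo_nonneg (hp : p ∈ stdSimplex ℝ Ω) (A : Ω → α) (B : Ω → β) :
    0 ≤ finiteInfo p A B := by
  have hAB := pushLaw_mem_stdSimplex hp fun ω => (A ω, B ω)
  have hA := pushLaw_mem_stdSimplex hp A
  have hB := pushLaw_mem_stdSimplex hp B
  have hmarg : ∀ a b, 0 < pushLaw p (fun ω => (A ω, B ω)) (a, b) →
      0 < pushLaw p A a ∧ 0 < pushLaw p B b := by
    intro a b h
    have h1 : pushLaw p A = pushLaw (pushLaw p fun ω => (A ω, B ω)) Prod.fst :=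
      (pushLaw_pushLaw p (fun ω => (A ω, B ω)) Prod.fst).symm
    have h2 : pushLaw p B = pushLaw (pushLaw p fun ω => (A ω, B ω)) Prod.snd :=
      (pushLaw_pushLaw p (fun ω => (A ω, B ω)) Prod.snd).symm
    rw [h1, h2]
    exact ⟨pushLaw_pos hAB Prod.fst h, pushLaw_pos hAB Prod.snd h⟩
  have hlog : 0 < Real.log 2 := Real.log_pos (by norm_num)
  have hterm : ∀ a b, (pushLaw p (fun ω => (A ω, B ω)) (a, b) - pushLaw p A a * pushLaw p B b)
      / Real.log 2 ≤ pushLaw p (fun ω => (A ω, B ω)) (a, b) *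
    Real.logb 2 (pushLaw p (fun ω => (A ω, B ω)) (a, b) / (pushLaw p A a * pushLaw p B b)) := by
    intro a b
    rw [Real.logb, mul_div_assoc']
    refine div_le_div_of_nonneg_right ?_ hlog.le
    rcases (hAB.1 (a, b)).eq_or_lt with h | h
    · rw [← h]
      have := mul_nonneg (hA.1 a) (hB.1 b)
      simpa using this
    · obtain ⟨ha, hb⟩ := hmarg a b h
      have h1 := Real.one_sub_inv_le_log_of_pos (div_pos h (mul_pos ha hb))
      refine le_trans (le_of_eq ?_) (mul_le_mul_of_nonneg_left h1 h.le)
      rw [inv_div, mul_sub, mul_one, mul_div_cancel₀ _ h.ne']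
  refine le_trans (le_of_eq ?_) (Finset.sum_le_sum fun a _ => Finset.sum_le_sum fun b _ => hterm a b)
  have h1 : ∑ a, ∑ b, pushLaw p (fun ω => (A ω, B ω)) (a, b) = 1 := by
    rw [← Fintype.sum_prod_type']
    exact hAB.2
  simp_rw [← Finset.sum_div, Finset.sum_sub_distrib, ← Finset.mul_sum, hB.2, mul_one]
  rw [h1, hA.2, sub_self, zero_div]

lemma finiteInfo_pushLaw {Ω' : Type*} [Fintype Ω'] (p : Ω' → ℝ) (g : Ω' → Ω) (A : Ω → α)
    (B : Ω → β) :
    finiteInfo (pushLaw p g) A B = finiteInfo p (fun ω => A (g ω)) (fun ω => B (g ω)) := by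
  unfold finiteInfo
  simp_rw [pushLaw_pushLaw]

end PushLaw

/-! ### Typicality of likelihood ratios -/

section Typical

variable {Ω : Type*} [Fintype Ω] {p f g : Ω → ℝ}

/-- If the mean of `log₂ (f / g)` exceeds `R`, then the product of the ratios along an i.i.d.
sequence is at least `2 ^ (n R)` with high probability. -/
lemma tendsto_prod_lt (hp : p ∈ stdSimplex ℝ Ω) (hf : ∀ ω, 0 < p ω → 0 < f ω)
    (hg : ∀ ω, 0 < p ω → 0 < g ω) {R : ℝ} (hR : R < ∑ ω, p ω * Real.logb 2 (f ω / g ω)) :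
    Tendsto (fun n : ℕ => ∑ c : Fin n → Ω, (∏ k, p (c k)) *
      ind (∏ k, f (c k) < (2 : ℝ) ^ (n * R) * ∏ k, g (c k))) atTop (𝓝 0) := by
  set D := ∑ ω, p ω * Real.logb 2 (f ω / g ω) with hD
  have hlim := tendsto_iid_deviation hp (fun ω => Real.logb 2 (f ω / g ω)) (sub_pos.mpr hR)
  refine tendsto_of_tendsto_of_tendsto_of_le_of_le tendsto_const_nhds hlim ?_ ?_
  · exact fun n => Finset.sum_nonneg fun c _ =>
      mul_nonneg (Finset.prod_nonneg fun k _ => hp.1 _) (ind_nonneg _)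
  · intro n
    refine Finset.sum_le_sum fun c _ => ?_
    -- off the support of the law the logarithms of `f` and `g` would be junk values
    by_cases h0 : ∃ k, p (c k) = 0
    · obtain ⟨k, hk⟩ := h0
      rw [Finset.prod_eq_zero (Finset.mem_univ k) hk]; simp
    · have hpos : ∀ k, 0 < p (c k) := fun k =>
        lt_of_le_of_ne (hp.1 _) fun h => h0 ⟨k, h.symm⟩
      refine mul_le_mul_of_nonneg_left (ind_mono fun h => ?_)
        (Finset.prod_nonneg fun k _ => hp.1 _)
      have hf' : 0 < ∏ k, f (c k) := Finset.prod_pos fun k _ => hf _ (hpos k)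
      have hg' : 0 < ∏ k, g (c k) := Finset.prod_pos fun k _ => hg _ (hpos k)
      have h1 : ∑ k, Real.logb 2 (f (c k) / g (c k))
          = Real.logb 2 (∏ k, f (c k)) - Real.logb 2 (∏ k, g (c k)) := by
        rw [Real.logb_prod _ _ fun k _ => (hf _ (hpos k)).ne',
          Real.logb_prod _ _ fun k _ => (hg _ (hpos k)).ne', ← Finset.sum_sub_distrib]
        exact Finset.sum_congr rfl fun k _ =>
          Real.logb_div (hf _ (hpos k)).ne' (hg _ (hpos k)).ne'
      have h2 : Real.logb 2 (∏ k, f (c k)) < n * R + Real.logb 2 (∏ k, g (c k)) := by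
        calc _ < Real.logb 2 ((2 : ℝ) ^ (n * R) * ∏ k, g (c k)) :=
              Real.logb_lt_logb (by norm_num) hf' h
          _ = _ := by
              rw [Real.logb_mul (by positivity) hg'.ne', Real.logb_rpow (by norm_num) (by norm_num)]
      rw [h1, le_abs']
      left
      linarith

/-- The reverse bound: products of ratios above the exponential rate of the mean are atypical. -/
lemma tendsto_lt_prod (hp : p ∈ stdSimplex ℝ Ω) (hf : ∀ ω, 0 < p ω → 0 < f ω)
    (hg : ∀ ω, 0 < p ω → 0 < g ω) {R : ℝ} (hR : ∑ ω, p ω * Real.logb 2 (f ω / g ω) < R) :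
    Tendsto (fun n : ℕ => ∑ c : Fin n → Ω, (∏ k, p (c k)) *
      ind ((2 : ℝ) ^ (n * R) * ∏ k, g (c k) < ∏ k, f (c k))) atTop (𝓝 0) := by
  have h := tendsto_prod_lt (R := -R) hp hg hf (by
    have : ∑ ω, p ω * Real.logb 2 (g ω / f ω) = - ∑ ω, p ω * Real.logb 2 (f ω / g ω) := by
      rw [← Finset.sum_neg_distrib]
      refine Finset.sum_congr rfl fun ω _ => ?_
      rw [← inv_div, Real.logb_inv, mul_neg]
    rw [this]
    exact neg_lt_neg hR)
  refine h.congr fun n => Finset.sum_congr rfl fun c _ => ?_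
  congr 2
  rw [mul_neg, Real.rpow_neg (by norm_num), lt_inv_mul_iff₀ (by positivity)]

end Typical

/-! ### The random coding bound for long blocks -/

section Blocks

lemma outLaw_prod {S U : Type*} [Fintype S] (p : S → ℝ) (q : S → U → ℝ) (n : ℕ) (u : Fin n → U) :
    outLaw (fun s : Fin n → S => ∏ i, p (s i)) (fun s (u : Fin n → U) => ∏ i, q (s i) (u i)) u
      = ∏ i, outLaw p q (u i) := by
  unfold outLaw
  simp_rw [← Finset.prod_mul_distrib]
  exact sum_prod_apply fun i s => p s * q s (u i)

variable {S U V Y : Type*} [Fintype S] [Fintype U] [Fintype V] [Fintype Y]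
  {p : S → ℝ} {q : S → U → ℝ} {q' : S → V → ℝ} {K : S → U → V → Y → ℝ}

/-- The joint law of `(S, U)`. -/
def pairLaw (p : S → ℝ) (q : S → U → ℝ) (ω : S × U) : ℝ := p ω.1 * q ω.1 ω.2

/-- The joint law of `(S, U, V, Y)` in `jointExp`. -/
def letterLaw (p : S → ℝ) (q : S → U → ℝ) (q' : S → V → ℝ) (K : S → U → V → Y → ℝ)
    (ω : S × U × V × Y) : ℝ :=
  p ω.1 * q ω.1 ω.2.1 * q' ω.1 ω.2.2.1 * K ω.1 ω.2.1 ω.2.2.1 ω.2.2.2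

lemma pairLaw_mem_stdSimplex (hp : p ∈ stdSimplex ℝ S) (hq : ∀ s, q s ∈ stdSimplex ℝ U) :
    pairLaw p q ∈ stdSimplex ℝ (S × U) := by
  refine ⟨fun ω => mul_nonneg (hp.1 _) ((hq _).1 _), ?_⟩
  simp only [pairLaw, Fintype.sum_prod_type, ← Finset.mul_sum, (hq _).2, mul_one, hp.2]

lemma letterLaw_mem_stdSimplex (hp : p ∈ stdSimplex ℝ S) (hq : ∀ s, q s ∈ stdSimplex ℝ U)
    (hq' : ∀ s, q' s ∈ stdSimplex ℝ V) (hK : ∀ s u v, K s u v ∈ stdSimplex ℝ Y) :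
    letterLaw p q q' K ∈ stdSimplex ℝ (S × U × V × Y) := by
  refine ⟨fun ω => mul_nonneg (mul_nonneg (mul_nonneg (hp.1 _) ((hq _).1 _)) ((hq' _).1 _))
    ((hK _ _ _).1 _), ?_⟩
  simp only [letterLaw, Fintype.sum_prod_type, ← Finset.mul_sum, (hq _).2, (hq' _).2, (hK _ _ _).2,
    mul_one, hp.2]

lemma pushLaw_pairLaw_fst (hq : ∀ s, q s ∈ stdSimplex ℝ U) :
    pushLaw (pairLaw p q) (fun ω => ω.1) = p := by
  funext s
  simp only [pushLaw, pairLaw, Fintype.sum_prod_type]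
  simp_rw [← Finset.sum_mul, ← Finset.mul_sum, (hq _).2, mul_one]
  rw [Finset.sum_eq_single s]
  · rw [ind_of rfl, mul_one]
  · intro t _ ht
    rw [ind_of_not ht, mul_zero]
  · simp

lemma pushLaw_pairLaw_snd (p : S → ℝ) (q : S → U → ℝ) :
    pushLaw (pairLaw p q) (fun ω => ω.2) = outLaw p q := by
  funext u
  simp only [pushLaw, pairLaw, outLaw, Fintype.sum_prod_type]
  refine Finset.sum_congr rfl fun s _ => ?_
  rw [Finset.sum_eq_single u]
  · rw [ind_of rfl, mul_one]
  · intro t _ ht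
    rw [ind_of_not ht, mul_zero]
  · simp

lemma pushLaw_letterLaw_pair (hq' : ∀ s, q' s ∈ stdSimplex ℝ V)
    (hK : ∀ s u v, K s u v ∈ stdSimplex ℝ Y) :
    pushLaw (letterLaw p q q' K) (fun ω => (ω.1, ω.2.1)) = pairLaw p q := by
  funext ⟨s, u⟩
  simp only [pushLaw, letterLaw, Fintype.sum_prod_type]
  simp_rw [← Finset.sum_mul, ← Finset.mul_sum, (hK _ _ _).2, mul_one, ← Finset.mul_sum, (hq' _).2,
    mul_one]
  have := Finset.sum_eq_single (s := (Finset.univ : Finset (S × U)))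
    (f := fun ω => p ω.1 * q ω.1 ω.2 * ind (ω = (s, u))) (s, u)
    (fun ω _ hω => by rw [ind_of_not hω, mul_zero]) (by simp)
  rw [Fintype.sum_prod_type] at this
  rw [this, ind_of rfl, mul_one, pairLaw]

lemma pushLaw_letterLaw_aux (hq' : ∀ s, q' s ∈ stdSimplex ℝ V)
    (hK : ∀ s u v, K s u v ∈ stdSimplex ℝ Y) :
    pushLaw (letterLaw p q q' K) (fun ω => ω.2.1) = outLaw p q := by
  rw [← pushLaw_pairLaw_snd, ← pushLaw_letterLaw_pair hq' hK, pushLaw_pushLaw]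

lemma pushLaw_letterLaw_aux' (hq : ∀ s, q s ∈ stdSimplex ℝ U)
    (hK : ∀ s u v, K s u v ∈ stdSimplex ℝ Y) :
    pushLaw (letterLaw p q q' K) (fun ω => ω.2.2.1) = outLaw p q' := by
  rw [← pushLaw_letterLaw_aux (p := p) (q := q') (q' := q) (K := fun s v u => K s u v) hq
    (fun s v u => hK s u v)]
  funext v
  simp only [pushLaw, letterLaw, Fintype.sum_prod_type]
  refine Finset.sum_congr rfl fun s _ => ?_
  rw [Finset.sum_comm]
  exact Finset.sum_congr rfl fun v _ => Finset.sum_congr rfl fun u _ =>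
    Finset.sum_congr rfl fun y _ => by ring

/-- The covering bound vanishes for rates above the mutual information of state and codeword. -/
lemma tendsto_coveringBound (hp : p ∈ stdSimplex ℝ S) (hq : ∀ s, q s ∈ stdSimplex ℝ U) {t : ℝ}
    (ht : finiteInfo (pairLaw p q) (fun ω => ω.1) (fun ω => ω.2) < t) {L : ℕ → ℝ}
    (hL : Tendsto (fun n : ℕ => (2 : ℝ) ^ (n * t) / L n) atTop (𝓝 0)) :
    Tendsto (fun n : ℕ => coveringBound (fun s : Fin n → S => ∏ i, p (s i))
      (fun s (u : Fin n → U) => ∏ i, q (s i) (u i)) ((2 : ℝ) ^ (n * t)) (L n)) atTop (𝓝 0) := by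
  have hpq := pairLaw_mem_stdSimplex hp hq
  have hq0 : ∀ ω, 0 < pairLaw p q ω → 0 < q ω.1 ω.2 := fun ω h =>
    lt_of_le_of_ne ((hq _).1 _) fun h0 => by simp [pairLaw, ← h0] at h
  have hp0 : ∀ ω, 0 < pairLaw p q ω → 0 < p ω.1 := fun ω h =>
    lt_of_le_of_ne (hp.1 _) fun h0 => by simp [pairLaw, ← h0] at h
  have hP0 : ∀ ω, 0 < pairLaw p q ω → 0 < outLaw p q ω.2 := fun ω h => by
    rw [← pushLaw_pairLaw_snd]
    exact pushLaw_pos hpq (fun ω => ω.2) h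
  have hD : ∑ ω, pairLaw p q ω * Real.logb 2 (q ω.1 ω.2 / outLaw p q ω.2) < t := by
    refine lt_of_eq_of_lt ?_ ht
    rw [finiteInfo_eq_sum, pushLaw_pairLaw_fst hq, pushLaw_pairLaw_snd]
    refine Finset.sum_congr rfl fun ω _ => ?_
    rcases (hpq.1 ω).eq_or_lt with h | h
    · rw [← h]; ring
    · have hid : pushLaw (pairLaw p q) (fun ω => (ω.1, ω.2)) = pairLaw p q := pushLaw_id _
      rw [hid, pairLaw, mul_div_mul_left _ _ (hp0 ω h).ne']
  have hlim := tendsto_lt_prod (f := fun ω => q ω.1 ω.2) (g := fun ω => outLaw p q ω.2)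
    hpq hq0 hP0 hD
  have hsum := (hL.add hlim).const_mul 8
  rw [add_zero, mul_zero] at hsum
  refine hsum.congr fun n => ?_
  unfold coveringBound
  congr 2
  simp_rw [outLaw_prod, Finset.mul_sum]
  rw [sum_sum_arrow]
  refine Finset.sum_congr rfl fun c _ => ?_
  rw [← mul_assoc, ← Finset.prod_mul_distrib]
  rfl

lemma jointExp_prod (n : ℕ) (f : (Fin n → S) → (Fin n → U) → (Fin n → V) → (Fin n → Y) → ℝ) :
    jointExp (fun s : Fin n → S => ∏ i, p (s i)) (fun s (u : Fin n → U) => ∏ i, q (s i) (u i))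
        (fun s (v : Fin n → V) => ∏ i, q' (s i) (v i))
        (fun s u v (y : Fin n → Y) => ∏ i, K (s i) (u i) (v i) (y i)) f
      = ∑ ω : Fin n → S × U × V × Y, (∏ i, letterLaw p q q' K (ω i)) *
          f (fun i => (ω i).1) (fun i => (ω i).2.1) (fun i => (ω i).2.2.1)
            (fun i => (ω i).2.2.2) := by
  unfold jointExp
  simp_rw [← Finset.prod_mul_distrib]
  simp_rw [sum_sum_arrow]
  rfl

/-- The threshold test of a receiver for blocks of length `n`: the codeword pair and the output are
jointly likely, compared with a wrong first codeword, and compared with a wrong second one. -/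
def blockTest (P : U × V × Y → ℝ) (a b : ℝ) (n : ℕ) (u : Fin n → U) (v : Fin n → V)
    (y : Fin n → Y) : Prop :=
  (2 : ℝ) ^ (n * a) * ∏ i, (pushLaw P (fun ω => ω.1) (u i) * pushLaw P (fun ω => ω.2) (v i, y i))
      ≤ ∏ i, P (u i, v i, y i) ∧
  (2 : ℝ) ^ (n * b) * ∏ i, (pushLaw P (fun ω => ω.2.1) (v i) * pushLaw P (fun ω => ω.2.2) (y i))
      ≤ ∏ i, pushLaw P (fun ω => ω.2) (v i, y i)

/-- Change of measure: a first codeword that is independent of `(V, Y)` passes the test with probability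
at most `2 ^ (-n a)`. -/
lemma sum_blockTest_le {P : U × V × Y → ℝ} (hP : P ∈ stdSimplex ℝ (U × V × Y)) (a b : ℝ) (n : ℕ) :
    ∑ u : Fin n → U, ∑ c : Fin n → V × Y, (∏ i, pushLaw P (fun ω => ω.1) (u i)) *
        (∏ i, pushLaw P (fun ω => ω.2) (c i)) *
        ind (blockTest P a b n u (fun i => (c i).1) (fun i => (c i).2))
      ≤ (2 : ℝ) ^ (-(n * a)) := by
  have h1 : ∑ u : Fin n → U, ∑ c : Fin n → V × Y, ∏ i, P (u i, c i) = 1 := by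
    rw [sum_sum_arrow]
    exact (iid_mem_stdSimplex hP).2
  rw [← mul_one ((2 : ℝ) ^ (-(n * a))), ← h1, Finset.mul_sum]
  refine Finset.sum_le_sum fun u _ => ?_
  rw [Finset.mul_sum]
  refine Finset.sum_le_sum fun c _ => ?_
  have hnn : 0 ≤ ∏ i, P (u i, c i) := Finset.prod_nonneg fun i _ => hP.1 _
  by_cases h : blockTest P a b n u (fun i => (c i).1) (fun i => (c i).2)
  · rw [ind_of h, mul_one, ← Finset.prod_mul_distrib, Real.rpow_neg (by norm_num),
      le_inv_mul_iff₀ (by positivity)]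
    exact h.1
  · rw [ind_of_not h, mul_zero]
    positivity

/-- Two codewords that are independent of each other and of the output pass the test with probability
at most `2 ^ (-n (a + b))`, because the two inequalities of the test multiply. -/
lemma sum_blockTest_le' {P : U × V × Y → ℝ} (hP : P ∈ stdSimplex ℝ (U × V × Y)) (a b : ℝ) (n : ℕ) :
    ∑ u : Fin n → U, ∑ v : Fin n → V, ∑ y : Fin n → Y, (∏ i, pushLaw P (fun ω => ω.1) (u i)) *
        (∏ i, pushLaw P (fun ω => ω.2.1) (v i)) * (∏ i, pushLaw P (fun ω => ω.2.2) (y i)) *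
        ind (blockTest P a b n u v y)
      ≤ (2 : ℝ) ^ (-(n * (a + b))) := by
  have h1 : ∑ u : Fin n → U, ∑ v : Fin n → V, ∑ y : Fin n → Y, ∏ i, P (u i, v i, y i) = 1 := by
    simp_rw [sum_sum_arrow]
    exact (iid_mem_stdSimplex hP).2
  rw [← mul_one ((2 : ℝ) ^ (-(n * (a + b)))), ← h1]
  simp_rw [Finset.mul_sum]
  refine Finset.sum_le_sum fun u _ => Finset.sum_le_sum fun v _ => Finset.sum_le_sum fun y _ => ?_
  have hnn : 0 ≤ ∏ i, P (u i, v i, y i) := Finset.prod_nonneg fun i _ => hP.1 _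
  have hnu : 0 ≤ ∏ i, pushLaw P (fun ω => ω.1) (u i) :=
    Finset.prod_nonneg fun i _ => (pushLaw_mem_stdSimplex hP _).1 _
  by_cases h : blockTest P a b n u v y
  · rw [ind_of h, mul_one, Real.rpow_neg (by norm_num), le_inv_mul_iff₀ (by positivity)]
    obtain ⟨ha, hb⟩ := h
    rw [Finset.prod_mul_distrib] at ha hb
    calc (2 : ℝ) ^ (n * (a + b)) * ((∏ i, pushLaw P (fun ω => ω.1) (u i)) *
          (∏ i, pushLaw P (fun ω => ω.2.1) (v i)) * (∏ i, pushLaw P (fun ω => ω.2.2) (y i)))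
        = (2 : ℝ) ^ (n * a) * (∏ i, pushLaw P (fun ω => ω.1) (u i)) * ((2 : ℝ) ^ (n * b) *
          ((∏ i, pushLaw P (fun ω => ω.2.1) (v i)) *
            (∏ i, pushLaw P (fun ω => ω.2.2) (y i)))) := by
          rw [mul_add, Real.rpow_add (by norm_num)]; ring
      _ ≤ (2 : ℝ) ^ (n * a) * (∏ i, pushLaw P (fun ω => ω.1) (u i)) *
          ∏ i, pushLaw P (fun ω => ω.2) (v i, y i) :=
          mul_le_mul_of_nonneg_left hb (by positivity)
      _ ≤ _ := by rw [mul_assoc]; exact ha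
  · rw [ind_of_not h, mul_zero]
    positivity

/-- The error bound of one receiver vanishes if `a < I(U; V Y)`, `b < I(V; Y)`, and the numbers of
wrong codewords and of wrong codeword pairs are of smaller order than `2 ^ (n a)` and
`2 ^ (n (a + b))`. -/
lemma tendsto_receiverBound (hp : p ∈ stdSimplex ℝ S) (hq : ∀ s, q s ∈ stdSimplex ℝ U)
    (hq' : ∀ s, q' s ∈ stdSimplex ℝ V) (hK : ∀ s u v, K s u v ∈ stdSimplex ℝ Y)
    {P : U × V × Y → ℝ} (hPdef : P = pushLaw (letterLaw p q q' K) (fun ω => ω.2)) {a b : ℝ}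
    (ha : a < finiteInfo P (fun ω => ω.1) (fun ω => ω.2))
    (hb : b < finiteInfo P (fun ω => ω.2.1) (fun ω => ω.2.2)) {x z : ℕ → ℝ} (hx0 : ∀ n, 0 ≤ x n)
    (hz0 : ∀ n, 0 ≤ z n) (hx : Tendsto (fun n : ℕ => x n * (2 : ℝ) ^ (-(n * a))) atTop (𝓝 0))
    (hz : Tendsto (fun n : ℕ => z n * (2 : ℝ) ^ (-(n * (a + b)))) atTop (𝓝 0)) :
    Tendsto (fun n : ℕ => receiverBound (fun s : Fin n → S => ∏ i, p (s i))
      (fun s (u : Fin n → U) => ∏ i, q (s i) (u i)) (fun s (v : Fin n → V) => ∏ i, q' (s i) (v i))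
      (fun s u v (y : Fin n → Y) => ∏ i, K (s i) (u i) (v i) (y i)) (blockTest P a b n)
      (x n) (z n)) atTop (𝓝 0) := by
  have hl := letterLaw_mem_stdSimplex hp hq hq' hK
  have hP : P ∈ stdSimplex ℝ (U × V × Y) := hPdef ▸ pushLaw_mem_stdSimplex hl _
  have hPu : outLaw p q = pushLaw P (fun ω => ω.1) := by
    rw [hPdef, pushLaw_pushLaw, pushLaw_letterLaw_aux hq' hK]
  have hPv : outLaw p q' = pushLaw P (fun ω => ω.2.1) := by
    rw [hPdef, pushLaw_pushLaw, pushLaw_letterLaw_aux' hq hK]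
  have hid : pushLaw P (fun ω => (ω.1, ω.2)) = P := pushLaw_id P
  have hlima := tendsto_prod_lt (f := P)
    (g := fun ω => pushLaw P (fun ω => ω.1) ω.1 * pushLaw P (fun ω => ω.2) ω.2) (R := a)
    hP (fun ω h => h)
    (fun ω h => mul_pos (pushLaw_pos hP (fun ω => ω.1) h) (pushLaw_pos hP (fun ω => ω.2) h))
    (by rwa [finiteInfo_eq_sum, hid] at ha)
  have hlimb := tendsto_prod_lt (f := fun ω => pushLaw P (fun ω => ω.2) ω.2)
    (g := fun ω => pushLaw P (fun ω => ω.2.1) ω.2.1 * pushLaw P (fun ω => ω.2.2) ω.2.2) (R := b)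
    hP (fun ω h => pushLaw_pos hP (fun ω => ω.2) h)
    (fun ω h => mul_pos (pushLaw_pos hP (fun ω => ω.2.1) h) (pushLaw_pos hP (fun ω => ω.2.2) h))
    (by rwa [finiteInfo_eq_sum] at hb)
  have hlim := ((hlima.add hlimb).add hx).add hz
  simp only [add_zero] at hlim
  have hpn := fun n => iid_mem_stdSimplex (ι := Fin n) hp
  have hqn : ∀ n (s : Fin n → S), (fun u : Fin n → U => ∏ i, q (s i) (u i)) ∈
      stdSimplex ℝ (Fin n → U) := fun n s => prod_mem_stdSimplex fun i => hq (s i)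
  have hqn' : ∀ n (s : Fin n → S), (fun v : Fin n → V => ∏ i, q' (s i) (v i)) ∈
      stdSimplex ℝ (Fin n → V) := fun n s => prod_mem_stdSimplex fun i => hq' (s i)
  refine tendsto_of_tendsto_of_tendsto_of_le_of_le tendsto_const_nhds hlim ?_ ?_
  · intro n
    have hE : ∀ f : (Fin n → S) → (Fin n → U) → (Fin n → V) → (Fin n → Y) → ℝ,
        (∀ s u v y, 0 ≤ f s u v y) → 0 ≤ jointExp (fun s : Fin n → S => ∏ i, p (s i))
        (fun s (u : Fin n → U) => ∏ i, q (s i) (u i)) (fun s (v : Fin n → V) => ∏ i, q' (s i) (v i))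
        (fun s u v (y : Fin n → Y) => ∏ i, K (s i) (u i) (v i) (y i)) f := fun f hf =>
      jointExp_nonneg (hpn n) (hqn n) (hqn' n)
        (fun s u v y => Finset.prod_nonneg fun i _ => (hK _ _ _).1 _) hf
    exact add_nonneg (add_nonneg (hE _ fun _ _ _ _ => ind_nonneg _)
      (mul_nonneg (hx0 n) (Finset.sum_nonneg fun u _ => mul_nonneg
        ((outLaw_mem_stdSimplex (hpn n) (hqn n)).1 u) (hE _ fun _ _ _ _ => ind_nonneg _))))
      (mul_nonneg (hz0 n) (Finset.sum_nonneg fun u _ => Finset.sum_nonneg fun v _ =>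
        mul_nonneg (mul_nonneg ((outLaw_mem_stdSimplex (hpn n) (hqn n)).1 u)
          ((outLaw_mem_stdSimplex (hpn n) (hqn' n)).1 v)) (hE _ fun _ _ _ _ => ind_nonneg _)))
  · intro n
    unfold receiverBound
    simp_rw [jointExp_prod, outLaw_prod]
    refine add_le_add (add_le_add ?_ ?_) ?_
    · rw [sum_iid_comp (letterLaw p q q' K) (fun ω => ω.2) fun c => ind (¬ blockTest P a b n
        (fun i => (c i).1) (fun i => (c i).2.1) (fun i => (c i).2.2)), ← hPdef,
        ← Finset.sum_add_distrib]
      refine Finset.sum_le_sum fun c _ => ?_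
      rw [← mul_add]
      refine mul_le_mul_of_nonneg_left ((ind_mono fun h => ?_).trans (ind_or_le _ _))
        (Finset.prod_nonneg fun i _ => hP.1 _)
      unfold blockTest at h
      rw [not_and_or, not_le, not_le] at h
      exact h
    · refine mul_le_mul_of_nonneg_left ?_ (hx0 n)
      refine le_of_eq_of_le (Finset.sum_congr rfl fun u _ => ?_) (sum_blockTest_le hP a b n)
      rw [sum_iid_comp (letterLaw p q q' K) (fun ω => ω.2.2) fun c => ind (blockTest P a b n
        u (fun i => (c i).1) (fun i => (c i).2)), Finset.mul_sum]
      refine Finset.sum_congr rfl fun c _ => ?_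
      rw [hPu, hPdef, pushLaw_pushLaw _ _ fun ω : U × V × Y => ω.2, mul_assoc]
    · refine mul_le_mul_of_nonneg_left ?_ (hz0 n)
      refine le_of_eq_of_le (Finset.sum_congr rfl fun u _ => Finset.sum_congr rfl fun v _ => ?_)
        (sum_blockTest_le' hP a b n)
      rw [sum_iid_comp (letterLaw p q q' K) (fun ω => ω.2.2.2) fun y => ind (blockTest P a b n
        u v y), Finset.mul_sum]
      refine Finset.sum_congr rfl fun c _ => ?_
      rw [hPu, hPv, hPdef, pushLaw_pushLaw _ _ fun ω : U × V × Y => ω.2.2]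
      ring

end Blocks

/-! ### Codes for long blocks -/

section Rates

lemma tendsto_two_rpow {x : ℝ} (hx : x < 0) :
    Tendsto (fun n : ℕ => (2 : ℝ) ^ (n * x)) atTop (𝓝 0) := by
  have h := tendsto_pow_atTop_nhds_zero_of_lt_one (r := (2 : ℝ) ^ x) (by positivity)
    (Real.rpow_lt_one_of_one_lt_of_neg (by norm_num) hx)
  refine h.congr fun n => ?_
  rw [← Real.rpow_natCast, ← Real.rpow_mul (by norm_num), mul_comm]

lemma ceil_two_rpow_le {R : ℝ} (hR : 0 ≤ R) (n : ℕ) :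
    (⌈(2 : ℝ) ^ (n * R)⌉₊ : ℝ) ≤ 2 * (2 : ℝ) ^ (n * R) := by
  have h1 : 1 ≤ (2 : ℝ) ^ (n * R) := Real.one_le_rpow (by norm_num) (by positivity)
  linarith [Nat.ceil_lt_add_one (a := (2 : ℝ) ^ (n * R)) (by positivity)]

lemma ceil_two_rpow_sub_one_le (R : ℝ) (n : ℕ) :
    (⌈(2 : ℝ) ^ (n * R)⌉₊ : ℝ) - 1 ≤ (2 : ℝ) ^ (n * R) := by
  linarith [Nat.ceil_lt_add_one (a := (2 : ℝ) ^ (n * R)) (by positivity)]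

lemma ceil_two_rpow_sub_one_nonneg (R : ℝ) (n : ℕ) :
    0 ≤ (⌈(2 : ℝ) ^ (n * R)⌉₊ : ℝ) - 1 := by
  have : 1 ≤ ⌈(2 : ℝ) ^ (n * R)⌉₊ := Nat.one_le_iff_ne_zero.mpr
    (Nat.ceil_pos.mpr (by positivity)).ne'
  rw [sub_nonneg]
  exact_mod_cast this

/-- The number of wrong codewords of a receiver is of smaller order than `2 ^ (n a)`.  At rate `0`
there is one message only, and no wrong codeword. -/
lemma tendsto_wrong_codewords {R r a : ℝ} (hr : 0 ≤ r) (h : R = 0 ∨ R + r < a) :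
    Tendsto (fun n : ℕ => ((⌈(2 : ℝ) ^ (n * R)⌉₊ : ℝ) - 1) * ⌈(2 : ℝ) ^ (n * r)⌉₊ *
      (2 : ℝ) ^ (-(n * a))) atTop (𝓝 0) := by
  rcases h with h | h
  · simp [h]
  have hlim := (tendsto_two_rpow (sub_neg.mpr h)).const_mul 2
  rw [mul_zero] at hlim
  refine tendsto_of_tendsto_of_tendsto_of_le_of_le tendsto_const_nhds hlim ?_ ?_
  · exact fun n => mul_nonneg (mul_nonneg (ceil_two_rpow_sub_one_nonneg R n) (by positivity))
      (by positivity)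
  · intro n
    calc _ ≤ (2 : ℝ) ^ (n * R) * (2 * (2 : ℝ) ^ (n * r)) * (2 : ℝ) ^ (-(n * a)) := by
          refine mul_le_mul_of_nonneg_right (mul_le_mul (ceil_two_rpow_sub_one_le R n)
            (ceil_two_rpow_le hr n) (by positivity) (by positivity)) (by positivity)
      _ = 2 * ((2 : ℝ) ^ (n * R) * (2 : ℝ) ^ (n * r) * (2 : ℝ) ^ (-(n * a))) := by ring
      _ = _ := by
          rw [← Real.rpow_add (by norm_num), ← Real.rpow_add (by norm_num)]
          ring_nf

lemma tendsto_wrong_pairs {R r R' r' a : ℝ} (hr : 0 ≤ r) (hR' : 0 ≤ R') (hr' : 0 ≤ r')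
    (h : R = 0 ∨ R + r + (R' + r') < a) :
    Tendsto (fun n : ℕ => ((⌈(2 : ℝ) ^ (n * R)⌉₊ : ℝ) - 1) * ⌈(2 : ℝ) ^ (n * r)⌉₊ *
      (⌈(2 : ℝ) ^ (n * R')⌉₊ * ⌈(2 : ℝ) ^ (n * r')⌉₊) * (2 : ℝ) ^ (-(n * a))) atTop (𝓝 0) := by
  have h' : R = 0 ∨ R + r < a - (R' + r') := h.imp id fun h => by linarith
  have hlim := (tendsto_wrong_codewords hr h').const_mul 4
  rw [mul_zero] at hlim
  refine tendsto_of_tendsto_of_tendsto_of_le_of_le tendsto_const_nhds hlim ?_ ?_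
  · exact fun n => mul_nonneg (mul_nonneg (mul_nonneg (ceil_two_rpow_sub_one_nonneg R n)
      (by positivity)) (by positivity)) (by positivity)
  · intro n
    have h0 := ceil_two_rpow_sub_one_nonneg R n
    calc _ ≤ ((⌈(2 : ℝ) ^ (n * R)⌉₊ : ℝ) - 1) * ⌈(2 : ℝ) ^ (n * r)⌉₊ *
          ((2 * (2 : ℝ) ^ (n * R')) * (2 * (2 : ℝ) ^ (n * r'))) * (2 : ℝ) ^ (-(n * a)) := by
          have h1 := ceil_two_rpow_le hR' n
          have h2 := ceil_two_rpow_le hr' n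
          exact mul_le_mul_of_nonneg_right (mul_le_mul_of_nonneg_left
            (mul_le_mul h1 h2 (by positivity) (by positivity))
            (mul_nonneg h0 (Nat.cast_nonneg _))) (by positivity)
      _ = 4 * (((⌈(2 : ℝ) ^ (n * R)⌉₊ : ℝ) - 1) * ⌈(2 : ℝ) ^ (n * r)⌉₊ *
          ((2 : ℝ) ^ (n * R') * (2 : ℝ) ^ (n * r') * (2 : ℝ) ^ (-(n * a)))) := by ring
      _ = _ := by
          rw [← Real.rpow_add (by norm_num), ← Real.rpow_add (by norm_num)]
          ring_nf

lemma tendsto_threshold_div {t r : ℝ} (h : t < r) :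
    Tendsto (fun n : ℕ => (2 : ℝ) ^ (n * t) / ⌈(2 : ℝ) ^ (n * r)⌉₊) atTop (𝓝 0) := by
  refine tendsto_of_tendsto_of_tendsto_of_le_of_le tendsto_const_nhds
    (tendsto_two_rpow (sub_neg.mpr h)) (fun n => by positivity) fun n => ?_
  calc (2 : ℝ) ^ (n * t) / ⌈(2 : ℝ) ^ (n * r)⌉₊ ≤ (2 : ℝ) ^ (n * t) / (2 : ℝ) ^ (n * r) :=
        div_le_div_of_nonneg_left (by positivity) (by positivity) (Nat.le_ceil _)
    _ = _ := by
        rw [← Real.rpow_sub (by norm_num)]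
        ring_nf

end Rates

section BlockCodes

variable {S U V X₁ X₂ Y₁ Y₂ : Type*} [Fintype X₁] [Fintype X₂]
  {p : S → ℝ} {q₁ : S → U → ℝ} {q₂ : S → V → ℝ} {k₁ : U → S → X₁ → ℝ} {k₂ : V → S → X₂ → ℝ}
  {W : S → X₁ → X₂ → Y₁ → Y₂ → ℝ}

lemma auxChannel_prod (k₁ : U → S → X₁ → ℝ) (k₂ : V → S → X₂ → ℝ) (W : S → X₁ → X₂ → Y₁ → Y₂ → ℝ)
    (n : ℕ) (s : Fin n → S) (u : Fin n → U) (v : Fin n → V) (y₁ : Fin n → Y₁) (y₂ : Fin n → Y₂) :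
    auxChannel (fun (u : Fin n → U) (s : Fin n → S) (x : Fin n → X₁) => ∏ i, k₁ (u i) (s i) (x i))
      (fun (v : Fin n → V) (s : Fin n → S) (x : Fin n → X₂) => ∏ i, k₂ (v i) (s i) (x i))
      (fun (s : Fin n → S) x₁ x₂ (y₁ : Fin n → Y₁) (y₂ : Fin n → Y₂) =>
        ∏ i, W (s i) (x₁ i) (x₂ i) (y₁ i) (y₂ i)) s u v y₁ y₂
      = ∏ i, auxChannel k₁ k₂ W (s i) (u i) (v i) (y₁ i) (y₂ i) := by
  unfold auxChannel
  simp_rw [← Finset.prod_mul_distrib, ← Fintype.sum_prod_type']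
  rw [Fintype.sum_prod_type, sum_sum_arrow]
  exact sum_prod_apply fun i (x : X₁ × X₂) =>
    k₁ (u i) (s i) x.1 * k₂ (v i) (s i) x.2 * W (s i) x.1 x.2 (y₁ i) (y₂ i)

variable [Fintype S] [Fintype U] [Fintype V] [Fintype Y₁] [Fintype Y₂]

/-- Good block codes for the channel with single-letter laws `p`, `q₁`, `q₂`, `k₁`, `k₂`, `W`.  Each
receiver looks for its own message only, so at rate `0` it imposes no condition. -/
theorem exists_codes_tendsto (hp : p ∈ stdSimplex ℝ S) (hq₁ : ∀ s, q₁ s ∈ stdSimplex ℝ U)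
    (hq₂ : ∀ s, q₂ s ∈ stdSimplex ℝ V) (hk₁ : ∀ u s, k₁ u s ∈ stdSimplex ℝ X₁)
    (hk₂ : ∀ v s, k₂ v s ∈ stdSimplex ℝ X₂) (hW : ∀ s x₁ x₂ y₁ y₂, 0 ≤ W s x₁ x₂ y₁ y₂)
    (hW1 : ∀ s x₁ x₂, ∑ y₁, ∑ y₂, W s x₁ x₂ y₁ y₂ = 1)
    {P₁ : U × V × Y₁ → ℝ} {P₂ : V × U × Y₂ → ℝ}
    (hP₁ : P₁ = pushLaw (letterLaw p q₁ q₂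
      (fun s u v y₁ => ∑ y₂, auxChannel k₁ k₂ W s u v y₁ y₂)) (fun ω => ω.2))
    (hP₂ : P₂ = pushLaw (letterLaw p q₂ q₁
      (fun s v u y₂ => ∑ y₁, auxChannel k₁ k₂ W s u v y₁ y₂)) (fun ω => ω.2))
    {I₁ I₂ : ℝ} (hI₁ : I₁ = finiteInfo (pairLaw p q₁) (fun ω => ω.1) (fun ω => ω.2))
    (hI₂ : I₂ = finiteInfo (pairLaw p q₂) (fun ω => ω.1) (fun ω => ω.2))
    {R₁ R₂ : ℝ} (hR₁ : 0 ≤ R₁) (hR₂ : 0 ≤ R₂)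
    (h₁ : R₁ = 0 ∨ R₁ + I₁ < finiteInfo P₁ (fun ω => ω.1) (fun ω => ω.2) ∧
      R₁ + R₂ + I₁ + I₂ < finiteInfo P₁ (fun ω => ω.1) (fun ω => ω.2) +
        finiteInfo P₁ (fun ω => ω.2.1) (fun ω => ω.2.2))
    (h₂ : R₂ = 0 ∨ R₂ + I₂ < finiteInfo P₂ (fun ω => ω.1) (fun ω => ω.2) ∧
      R₁ + R₂ + I₁ + I₂ < finiteInfo P₂ (fun ω => ω.1) (fun ω => ω.2) +
        finiteInfo P₂ (fun ω => ω.2.1) (fun ω => ω.2.2)) :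
    ∃ (e₁ : ∀ n : ℕ, Fin ⌈(2 : ℝ) ^ (n * R₁)⌉₊ → (Fin n → S) → Fin n → X₁)
      (e₂ : ∀ n : ℕ, Fin ⌈(2 : ℝ) ^ (n * R₂)⌉₊ → (Fin n → S) → Fin n → X₂)
      (d₁ : ∀ n : ℕ, (Fin n → Y₁) → Fin ⌈(2 : ℝ) ^ (n * R₁)⌉₊)
      (d₂ : ∀ n : ℕ, (Fin n → Y₂) → Fin ⌈(2 : ℝ) ^ (n * R₂)⌉₊),
      Tendsto (fun n : ℕ => 1 / ((⌈(2 : ℝ) ^ (n * R₁)⌉₊ : ℝ) * ⌈(2 : ℝ) ^ (n * R₂)⌉₊) *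
        ∑ w₁, ∑ w₂, ∑ s : Fin n → S, (∏ i, p (s i)) * ∑ y₁ : Fin n → Y₁, ∑ y₂ : Fin n → Y₂,
          (∏ i, W (s i) (e₁ n w₁ s i) (e₂ n w₂ s i) (y₁ i) (y₂ i)) *
            ind (d₁ n y₁ ≠ w₁ ∨ d₂ n y₂ ≠ w₂)) atTop (𝓝 0) := by
  set K : S → U → V → Y₁ → Y₂ → ℝ := auxChannel k₁ k₂ W with hKdef
  have hK0 : ∀ s u v y₁ y₂, 0 ≤ K s u v y₁ y₂ := auxChannel_nonneg hk₁ hk₂ hW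
  have hK1 : ∀ s u v, ∑ y₁, ∑ y₂, K s u v y₁ y₂ = 1 := sum_auxChannel hk₁ hk₂ hW1
  have hKs₁ : ∀ s u v, (fun y₁ => ∑ y₂, K s u v y₁ y₂) ∈ stdSimplex ℝ Y₁ := fun s u v =>
    ⟨fun y₁ => Finset.sum_nonneg fun y₂ _ => hK0 s u v y₁ y₂, hK1 s u v⟩
  have hKs₂ : ∀ s v u, (fun y₂ => ∑ y₁, K s u v y₁ y₂) ∈ stdSimplex ℝ Y₂ := fun s v u =>
    ⟨fun y₂ => Finset.sum_nonneg fun y₁ _ => hK0 s u v y₁ y₂, by rw [Finset.sum_comm, hK1 s u v]⟩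
  have hI₁0 : 0 ≤ I₁ := hI₁ ▸ finiteInfo_nonneg (pairLaw_mem_stdSimplex hp hq₁) _ _
  have hI₂0 : 0 ≤ I₂ := hI₂ ▸ finiteInfo_nonneg (pairLaw_mem_stdSimplex hp hq₂) _ _
  set D₁ := finiteInfo P₁ (fun ω => ω.1) (fun ω => ω.2) with hD₁
  set D₂ := finiteInfo P₂ (fun ω => ω.1) (fun ω => ω.2) with hD₂
  set F₁ := finiteInfo P₁ (fun ω => ω.2.1) (fun ω => ω.2.2) with hF₁
  set F₂ := finiteInfo P₂ (fun ω => ω.2.1) (fun ω => ω.2.2) with hF₂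
  -- a common slack for all the strict inequalities; six multiples of it are spent at most
  have hslack : ∀ {R D F J : ℝ}, (R = 0 ∨ R + J < D ∧ R₁ + R₂ + I₁ + I₂ < D + F) →
      ∃ ε > 0, R = 0 ∨ R + J + 3 * ε < D ∧ R₁ + R₂ + I₁ + I₂ + 6 * ε < D + F := by
    rintro R D F J (h | ⟨h, h'⟩)
    · exact ⟨1, one_pos, Or.inl h⟩
    · refine ⟨min (D - (R + J)) (D + F - (R₁ + R₂ + I₁ + I₂)) / 12, ?_, Or.inr ⟨?_, ?_⟩⟩
      · have := lt_min (sub_pos.mpr h) (sub_pos.mpr h')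
        positivity
      · linarith [min_le_left (D - (R + J)) (D + F - (R₁ + R₂ + I₁ + I₂))]
      · linarith [min_le_right (D - (R + J)) (D + F - (R₁ + R₂ + I₁ + I₂))]
  obtain ⟨ε₁, hε₁, hs₁⟩ := hslack h₁
  obtain ⟨ε₂, hε₂, hs₂⟩ := hslack h₂
  set ε := min ε₁ ε₂ with hε
  have hεpos : 0 < ε := lt_min hε₁ hε₂
  have hle₁ : ε ≤ ε₁ := min_le_left _ _
  have hle₂ : ε ≤ ε₂ := min_le_right _ _
  set A₁ : ∀ n : ℕ, (Fin n → U) → (Fin n → V) → (Fin n → Y₁) → Prop :=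
    blockTest P₁ (D₁ - ε) (F₁ - ε)
  set A₂ : ∀ n : ℕ, (Fin n → V) → (Fin n → U) → (Fin n → Y₂) → Prop :=
    blockTest P₂ (D₂ - ε) (F₂ - ε)
  have hcode := fun n : ℕ => exists_code_error_le
    (M₁ := ⌈(2 : ℝ) ^ (n * R₁)⌉₊) (M₂ := ⌈(2 : ℝ) ^ (n * R₂)⌉₊)
    (L₁ := ⌈(2 : ℝ) ^ (n * (I₁ + 2 * ε))⌉₊) (L₂ := ⌈(2 : ℝ) ^ (n * (I₂ + 2 * ε))⌉₊)
    (Nat.ceil_pos.mpr (by positivity)) (Nat.ceil_pos.mpr (by positivity))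
    (Nat.ceil_pos.mpr (by positivity)) (Nat.ceil_pos.mpr (by positivity))
    (p := fun s : Fin n → S => ∏ i, p (s i))
    (q₁ := fun s (u : Fin n → U) => ∏ i, q₁ (s i) (u i))
    (q₂ := fun s (v : Fin n → V) => ∏ i, q₂ (s i) (v i))
    (k₁ := fun u s (x : Fin n → X₁) => ∏ i, k₁ (u i) (s i) (x i))
    (k₂ := fun v s (x : Fin n → X₂) => ∏ i, k₂ (v i) (s i) (x i))
    (W := fun s x₁ x₂ (y₁ : Fin n → Y₁) (y₂ : Fin n → Y₂) =>
      ∏ i, W (s i) (x₁ i) (x₂ i) (y₁ i) (y₂ i))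
    (iid_mem_stdSimplex hp) (fun s => prod_mem_stdSimplex fun i => hq₁ (s i))
    (fun s => prod_mem_stdSimplex fun i => hq₂ (s i))
    (fun u s => prod_mem_stdSimplex fun i => hk₁ (u i) (s i))
    (fun v s => prod_mem_stdSimplex fun i => hk₂ (v i) (s i))
    (fun s x₁ x₂ y₁ y₂ => Finset.prod_nonneg fun i _ => hW _ _ _ _ _)
    (fun s x₁ x₂ => by
      rw [sum_sum_arrow, sum_prod_apply fun i (y : Y₁ × Y₂) => W (s i) (x₁ i) (x₂ i) y.1 y.2]
      simp_rw [Fintype.sum_prod_type, hW1, Finset.prod_const_one])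
    (A₁ n) (A₂ n) (T₁ := (2 : ℝ) ^ (n * (I₁ + ε))) (T₂ := (2 : ℝ) ^ (n * (I₂ + ε)))
    (by positivity) (by positivity)
  choose e₁ e₂ d₁ d₂ hcode using hcode
  refine ⟨e₁, e₂, d₁, d₂, ?_⟩
  -- the block channel to one output is again a product
  have hK₁n : ∀ (n : ℕ) (s : Fin n → S) (u : Fin n → U) (v : Fin n → V) (y₁ : Fin n → Y₁),
      ∑ y₂ : Fin n → Y₂, ∏ i, auxChannel k₁ k₂ W (s i) (u i) (v i) (y₁ i) (y₂ i)
        = ∏ i, ∑ y₂, K (s i) (u i) (v i) (y₁ i) y₂ := fun n s u v y₁ =>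
    sum_prod_apply fun i y₂ => K (s i) (u i) (v i) (y₁ i) y₂
  have hK₂n : ∀ (n : ℕ) (s : Fin n → S) (u : Fin n → U) (v : Fin n → V) (y₂ : Fin n → Y₂),
      ∑ y₁ : Fin n → Y₁, ∏ i, auxChannel k₁ k₂ W (s i) (u i) (v i) (y₁ i) (y₂ i)
        = ∏ i, ∑ y₁, K (s i) (u i) (v i) y₁ (y₂ i) := fun n s u v y₂ =>
    sum_prod_apply fun i y₁ => K (s i) (u i) (v i) y₁ (y₂ i)
  simp_rw [auxChannel_prod, hK₁n, hK₂n] at hcode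
  have hrec₁ := tendsto_receiverBound hp hq₁ hq₂ hKs₁ hP₁ (a := D₁ - ε) (b := F₁ - ε)
    (by linarith) (by linarith)
    (fun n => mul_nonneg (ceil_two_rpow_sub_one_nonneg R₁ n) (Nat.cast_nonneg _))
    (fun n => mul_nonneg (mul_nonneg (ceil_two_rpow_sub_one_nonneg R₁ n) (Nat.cast_nonneg _))
      (by positivity))
    (tendsto_wrong_codewords (r := I₁ + 2 * ε) (by linarith)
      (hs₁.imp id fun h => by linarith [h.1]))
    (tendsto_wrong_pairs (r := I₁ + 2 * ε) (R' := R₂) (r' := I₂ + 2 * ε) (by linarith) hR₂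
      (by linarith) (hs₁.imp id fun h => by linarith [h.2]))
  have hrec₂ := tendsto_receiverBound hp hq₂ hq₁ hKs₂ hP₂ (a := D₂ - ε) (b := F₂ - ε)
    (by linarith) (by linarith)
    (fun n => mul_nonneg (ceil_two_rpow_sub_one_nonneg R₂ n) (Nat.cast_nonneg _))
    (fun n => mul_nonneg (mul_nonneg (ceil_two_rpow_sub_one_nonneg R₂ n) (Nat.cast_nonneg _))
      (by positivity))
    (tendsto_wrong_codewords (r := I₂ + 2 * ε) (by linarith)
      (hs₂.imp id fun h => by linarith [h.1]))
    (tendsto_wrong_pairs (r := I₂ + 2 * ε) (R' := R₁) (r' := I₁ + 2 * ε) (by linarith) hR₁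
      (by linarith) (hs₂.imp id fun h => by linarith [h.2]))
  have hcov₁ := tendsto_coveringBound hp hq₁ (t := I₁ + ε) (by rw [← hI₁]; linarith)
    (tendsto_threshold_div (r := I₁ + 2 * ε) (by linarith))
  have hcov₂ := tendsto_coveringBound hp hq₂ (t := I₂ + ε) (by rw [← hI₂]; linarith)
    (tendsto_threshold_div (r := I₂ + 2 * ε) (by linarith))
  have hlim := (((hrec₁.add hrec₂).const_mul 4).add hcov₁).add hcov₂
  simp only [add_zero, mul_zero] at hlim
  refine tendsto_of_tendsto_of_tendsto_of_le_of_le tendsto_const_nhds hlim (fun n => ?_) hcode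
  refine mul_nonneg (by positivity) (Finset.sum_nonneg fun w₁ _ => Finset.sum_nonneg fun w₂ _ =>
    Finset.sum_nonneg fun s _ => mul_nonneg (Finset.prod_nonneg fun i _ => hp.1 _)
      (Finset.sum_nonneg fun y₁ _ => Finset.sum_nonneg fun y₂ _ =>
        mul_nonneg (Finset.prod_nonneg fun i _ => hW _ _ _ _ _) (ind_nonneg _)))

end BlockCodes

/-! ### Achievable rates of the interference channel -/

section PMFReal

variable {α β Ω : Type*} [Fintype α] [Fintype β] [Fintype Ω]

lemma toReal_mem_stdSimplex (p : PMF α) : (fun a => (p a).toReal) ∈ stdSimplex ℝ α := by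
  refine ⟨fun a => ENNReal.toReal_nonneg, ?_⟩
  rw [← ENNReal.toReal_sum fun a _ => p.apply_ne_top a, ← tsum_fintype (L := .unconditional α),
    p.tsum_coe, ENNReal.toReal_one]

lemma sum_bind_toReal_mul (p : PMF α) (f : α → PMF β) (F : β → ℝ) :
    ∑ b, (p.bind f b).toReal * F b = ∑ a, (p a).toReal * ∑ b, (f a b).toReal * F b := by
  have h : ∀ b, (p.bind f b).toReal = ∑ a, (p a).toReal * (f a b).toReal := by
    intro b
    rw [PMF.bind_apply, tsum_fintype, ENNReal.toReal_sum fun a _ =>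
      ENNReal.mul_ne_top (p.apply_ne_top a) ((f a).apply_ne_top b)]
    simp_rw [ENNReal.toReal_mul]
  simp_rw [h, Finset.sum_mul, Finset.mul_sum, mul_assoc]
  exact Finset.sum_comm

lemma toReal_map {β : Type*} (p : PMF α) (g : α → β) (b : β) :
    (p.map g b).toReal = pushLaw (fun a => (p a).toReal) g b := by
  classical
  rw [PMF.map_apply, tsum_fintype, ENNReal.toReal_sum fun a _ => by
    split_ifs
    · exact p.apply_ne_top a
    · exact ENNReal.zero_ne_top]
  refine Finset.sum_congr rfl fun a _ => ?_
  by_cases h : g a = b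
  · rw [if_pos h.symm, ind_of h, mul_one]
  · rw [if_neg (Ne.symm h), ind_of_not h, mul_zero, ENNReal.toReal_zero]

lemma sum_map_toReal_mul (p : PMF α) (g : α → β) (F : β → ℝ) :
    ∑ b, (p.map g b).toReal * F b = ∑ a, (p a).toReal * F (g a) := by
  simp_rw [toReal_map]
  exact sum_pushLaw_mul _ g F

lemma mutualInfo_eq_finiteInfo (p : PMF Ω) (A : Ω → α) (B : Ω → β) :
    mutualInfo p A B = finiteInfo (fun ω => (p ω).toReal) A B := by
  simp only [mutualInfo, finiteInfo, toReal_map]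

end PMFReal

namespace StateIC

variable {S₁ S₂ X₁ X₂ Y₁ Y₂ U V : Type*} [Fintype S₁] [Fintype S₂] [Fintype X₁] [Fintype X₂]
  [Fintype Y₁] [Fintype Y₂] [Fintype U] [Fintype V]
  (C : StateIC S₁ S₂ X₁ X₂ Y₁ Y₂) (p : AuxLaw S₁ S₂ X₁ X₂ U V)

/-- The law of the pair of states, with real values. -/
def stateProb (C : StateIC S₁ S₂ X₁ X₂ Y₁ Y₂) (s : S₁ × S₂) : ℝ := (C.stateLaw s).toReal

/-- The transition probabilities of the channel, with real values. -/
def channelProb (C : StateIC S₁ S₂ X₁ X₂ Y₁ Y₂) (s : S₁ × S₂) (x₁ : X₁) (x₂ : X₂) (y₁ : Y₁)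
    (y₂ : Y₂) : ℝ := (C.channel s.1 s.2 x₁ x₂ (y₁, y₂)).toReal

/-- The channel from `(U, V)` to the outputs for given states. -/
noncomputable def auxProb (C : StateIC S₁ S₂ X₁ X₂ Y₁ Y₂) (p : AuxLaw S₁ S₂ X₁ X₂ U V) :
    S₁ × S₂ → U → V → Y₁ → Y₂ → ℝ :=
  auxChannel (fun u s x => (p.lawX₁ u s.1 s.2 x).toReal) (fun v s x => (p.lawX₂ v s.1 s.2 x).toReal)
    C.channelProb

lemma sum_jointLaw_mul (F : (S₁ × S₂) → U → V → Y₁ → Y₂ → ℝ) :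
    ∑ ω, (C.jointLaw p ω).toReal * F (ω.1, ω.2.1) ω.2.2.1 ω.2.2.2.1 ω.2.2.2.2.2.2.1
        ω.2.2.2.2.2.2.2
      = ∑ s, ∑ u, ∑ v, ∑ y₁, ∑ y₂, C.stateProb s * (p.lawU s.1 s.2 u).toReal *
          (p.lawV s.1 s.2 v).toReal * C.auxProb p s u v y₁ y₂ * F s u v y₁ y₂ := by
  unfold jointLaw
  rw [sum_bind_toReal_mul]
  simp_rw [sum_bind_toReal_mul, sum_map_toReal_mul, Fintype.sum_prod_type (α₁ := Y₁), auxProb,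
    auxChannel, Finset.mul_sum, Finset.sum_mul]
  refine Finset.sum_congr rfl fun s _ => Finset.sum_congr rfl fun u _ => ?_
  rw [Finset.sum_comm]
  refine Finset.sum_congr rfl fun v _ => ?_
  symm
  rw [Finset.sum_congr rfl fun y₁ _ => Finset.sum_comm, Finset.sum_comm]
  refine Finset.sum_congr rfl fun x₁ _ => ?_
  rw [Finset.sum_congr rfl fun y₁ _ => Finset.sum_comm, Finset.sum_comm]
  refine Finset.sum_congr rfl fun x₂ _ => Finset.sum_congr rfl fun y₁ _ =>
    Finset.sum_congr rfl fun y₂ _ => ?_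
  simp only [stateProb, channelProb]
  ring

lemma letterLaw_receiver₁ :
    letterLaw C.stateProb (fun s u => (p.lawU s.1 s.2 u).toReal)
        (fun s v => (p.lawV s.1 s.2 v).toReal) (fun s u v y₁ => ∑ y₂, C.auxProb p s u v y₁ y₂)
      = pushLaw (fun ω => (C.jointLaw p ω).toReal)
          (fun ω => ((ω.1, ω.2.1), ω.2.2.1, ω.2.2.2.1, ω.2.2.2.2.2.2.1)) := by
  rw [← pushLaw_id (letterLaw _ _ _ _)]
  funext ω'
  refine Eq.trans ?_ (C.sum_jointLaw_mul p fun s u v y₁ _ => ind ((s, u, v, y₁) = ω')).symm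
  simp only [pushLaw, letterLaw, Fintype.sum_prod_type, Finset.mul_sum, Finset.sum_mul]

lemma letterLaw_receiver₂ :
    letterLaw C.stateProb (fun s v => (p.lawV s.1 s.2 v).toReal)
        (fun s u => (p.lawU s.1 s.2 u).toReal) (fun s v u y₂ => ∑ y₁, C.auxProb p s u v y₁ y₂)
      = pushLaw (fun ω => (C.jointLaw p ω).toReal)
          (fun ω => ((ω.1, ω.2.1), ω.2.2.2.1, ω.2.2.1, ω.2.2.2.2.2.2.2)) := by
  rw [← pushLaw_id (letterLaw _ _ _ _)]
  funext ω'
  refine Eq.trans ?_ (C.sum_jointLaw_mul p fun s u v _ y₂ => ind ((s, v, u, y₂) = ω')).symm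
  simp only [pushLaw, letterLaw, Fintype.sum_prod_type, Finset.mul_sum, Finset.sum_mul]
  refine Finset.sum_congr rfl fun s₁ _ => Finset.sum_congr rfl fun s₂ _ => ?_
  rw [Finset.sum_comm]
  refine Finset.sum_congr rfl fun u _ => Finset.sum_congr rfl fun v _ => ?_
  rw [Finset.sum_comm]
  exact Finset.sum_congr rfl fun y₁ _ => Finset.sum_congr rfl fun y₂ _ => by ring

/-- A rate pair is achievable if each receiver either has nothing to decode or can jointly decode
the pair of codewords.  Here the codewords carry `I(S₁S₂; U)` and `I(S₁S₂; V)` bits per letter on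
top of the messages, and an error in the other user's codeword alone does no harm. -/
theorem mem_achievable {R₁ R₂ : ℝ} (hR₁ : 0 ≤ R₁) (hR₂ : 0 ≤ R₂)
    (h₁ : R₁ = 0 ∨
      R₁ + mutualInfo (C.jointLaw p) (fun ω => (ω.1, ω.2.1)) (fun ω => ω.2.2.1)
        < mutualInfo (C.jointLaw p) (fun ω => ω.2.2.1)
          (fun ω => (ω.2.2.2.1, ω.2.2.2.2.2.2.1)) ∧
      R₁ + R₂ + mutualInfo (C.jointLaw p) (fun ω => (ω.1, ω.2.1)) (fun ω => ω.2.2.1)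
        + mutualInfo (C.jointLaw p) (fun ω => (ω.1, ω.2.1)) (fun ω => ω.2.2.2.1)
        < mutualInfo (C.jointLaw p) (fun ω => ω.2.2.1)
          (fun ω => (ω.2.2.2.1, ω.2.2.2.2.2.2.1))
          + mutualInfo (C.jointLaw p) (fun ω => ω.2.2.2.1) (fun ω => ω.2.2.2.2.2.2.1))
    (h₂ : R₂ = 0 ∨
      R₂ + mutualInfo (C.jointLaw p) (fun ω => (ω.1, ω.2.1)) (fun ω => ω.2.2.2.1)
        < mutualInfo (C.jointLaw p) (fun ω => ω.2.2.2.1)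
          (fun ω => (ω.2.2.1, ω.2.2.2.2.2.2.2)) ∧
      R₁ + R₂ + mutualInfo (C.jointLaw p) (fun ω => (ω.1, ω.2.1)) (fun ω => ω.2.2.1)
        + mutualInfo (C.jointLaw p) (fun ω => (ω.1, ω.2.1)) (fun ω => ω.2.2.2.1)
        < mutualInfo (C.jointLaw p) (fun ω => ω.2.2.2.1)
          (fun ω => (ω.2.2.1, ω.2.2.2.2.2.2.2))
          + mutualInfo (C.jointLaw p) (fun ω => ω.2.2.1) (fun ω => ω.2.2.2.2.2.2.2)) :
    (R₁, R₂) ∈ C.achievable := by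
  have hq₁ : ∀ s : S₁ × S₂, (fun u => (p.lawU s.1 s.2 u).toReal) ∈ stdSimplex ℝ U :=
    fun s => toReal_mem_stdSimplex _
  have hq₂ : ∀ s : S₁ × S₂, (fun v => (p.lawV s.1 s.2 v).toReal) ∈ stdSimplex ℝ V :=
    fun s => toReal_mem_stdSimplex _
  have hk₁ : ∀ (u : U) (s : S₁ × S₂), (fun x => (p.lawX₁ u s.1 s.2 x).toReal) ∈ stdSimplex ℝ X₁ :=
    fun u s => toReal_mem_stdSimplex _
  have hk₂ : ∀ (v : V) (s : S₁ × S₂), (fun x => (p.lawX₂ v s.1 s.2 x).toReal) ∈ stdSimplex ℝ X₂ :=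
    fun v s => toReal_mem_stdSimplex _
  have hW : ∀ s x₁ x₂ y₁ y₂, 0 ≤ C.channelProb s x₁ x₂ y₁ y₂ := fun _ _ _ _ _ =>
    ENNReal.toReal_nonneg
  have hW1 : ∀ s x₁ x₂, ∑ y₁, ∑ y₂, C.channelProb s x₁ x₂ y₁ y₂ = 1 := fun s x₁ x₂ => by
    have := (toReal_mem_stdSimplex (C.channel s.1 s.2 x₁ x₂)).2
    rwa [Fintype.sum_prod_type] at this
  have hK0 : ∀ s u v y₁ y₂, 0 ≤ C.auxProb p s u v y₁ y₂ := auxChannel_nonneg hk₁ hk₂ hW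
  have hK1 : ∀ s u v, ∑ y₁, ∑ y₂, C.auxProb p s u v y₁ y₂ = 1 := sum_auxChannel hk₁ hk₂ hW1
  have hKs₁ : ∀ s u v, (fun y₁ => ∑ y₂, C.auxProb p s u v y₁ y₂) ∈ stdSimplex ℝ Y₁ := fun s u v =>
    ⟨fun y₁ => Finset.sum_nonneg fun y₂ _ => hK0 s u v y₁ y₂, hK1 s u v⟩
  have hKs₂ : ∀ s v u, (fun y₂ => ∑ y₁, C.auxProb p s u v y₁ y₂) ∈ stdSimplex ℝ Y₂ := fun s v u =>
    ⟨fun y₂ => Finset.sum_nonneg fun y₁ _ => hK0 s u v y₁ y₂, by rw [Finset.sum_comm, hK1 s u v]⟩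
  simp only [mutualInfo_eq_finiteInfo] at h₁ h₂
  have hpair₁ : pairLaw C.stateProb (fun s u => (p.lawU s.1 s.2 u).toReal)
      = pushLaw (fun ω => (C.jointLaw p ω).toReal) (fun ω => ((ω.1, ω.2.1), ω.2.2.1)) := by
    rw [← pushLaw_letterLaw_pair hq₂ hKs₁, letterLaw_receiver₁, pushLaw_pushLaw]
  have hpair₂ : pairLaw C.stateProb (fun s v => (p.lawV s.1 s.2 v).toReal)
      = pushLaw (fun ω => (C.jointLaw p ω).toReal) (fun ω => ((ω.1, ω.2.1), ω.2.2.2.1)) := by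
    rw [← pushLaw_letterLaw_pair hq₁ hKs₂, letterLaw_receiver₂, pushLaw_pushLaw]
  have hI₁ : finiteInfo (fun ω => (C.jointLaw p ω).toReal) (fun ω => (ω.1, ω.2.1))
      (fun ω => ω.2.2.1) = finiteInfo (pairLaw C.stateProb fun s u => (p.lawU s.1 s.2 u).toReal)
        (fun ω => ω.1) (fun ω => ω.2) := by
    rw [hpair₁, finiteInfo_pushLaw]
  have hI₂ : finiteInfo (fun ω => (C.jointLaw p ω).toReal) (fun ω => (ω.1, ω.2.1))
      (fun ω => ω.2.2.2.1) = finiteInfo (pairLaw C.stateProb fun s v => (p.lawV s.1 s.2 v).toReal)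
        (fun ω => ω.1) (fun ω => ω.2) := by
    rw [hpair₂, finiteInfo_pushLaw]
  have hP₁ : pushLaw (fun ω => (C.jointLaw p ω).toReal)
      (fun ω => (ω.2.2.1, ω.2.2.2.1, ω.2.2.2.2.2.2.1)) = pushLaw (letterLaw C.stateProb
        (fun s u => (p.lawU s.1 s.2 u).toReal) (fun s v => (p.lawV s.1 s.2 v).toReal)
        (fun s u v y₁ => ∑ y₂, C.auxProb p s u v y₁ y₂)) (fun ω => ω.2) := by
    rw [letterLaw_receiver₁, pushLaw_pushLaw]
  have hP₂ : pushLaw (fun ω => (C.jointLaw p ω).toReal)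
      (fun ω => (ω.2.2.2.1, ω.2.2.1, ω.2.2.2.2.2.2.2)) = pushLaw (letterLaw C.stateProb
        (fun s v => (p.lawV s.1 s.2 v).toReal) (fun s u => (p.lawU s.1 s.2 u).toReal)
        (fun s v u y₂ => ∑ y₁, C.auxProb p s u v y₁ y₂)) (fun ω => ω.2) := by
    rw [letterLaw_receiver₂, pushLaw_pushLaw]
  have hp : C.stateProb ∈ stdSimplex ℝ (S₁ × S₂) := toReal_mem_stdSimplex C.stateLaw
  obtain ⟨e₁, e₂, d₁, d₂, hlim⟩ := exists_codes_tendsto (R₁ := R₁) (R₂ := R₂)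
    hp hq₁ hq₂ hk₁ hk₂ hW hW1 hP₁ hP₂ hI₁ hI₂ hR₁ hR₂
    (by simpa only [finiteInfo_pushLaw] using h₁) (by simpa only [finiteInfo_pushLaw] using h₂)
  set c : ∀ n : ℕ, Code S₁ S₂ X₁ X₂ Y₁ Y₂ n ⌈(2 : ℝ) ^ ((n : ℝ) * R₁)⌉₊
      ⌈(2 : ℝ) ^ ((n : ℝ) * R₂)⌉₊ := fun n =>
    ⟨fun w s₁ s₂ => e₁ n w fun i => (s₁ i, s₂ i), fun w s₁ s₂ => e₂ n w fun i => (s₁ i, s₂ i),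
      d₁ n, d₂ n⟩ with hc
  have herr : ∀ (n : ℕ) w₁ w₂, ∑ s : Fin n → S₁ × S₂, (∏ i, C.stateProb (s i)) *
      ∑ y₁ : Fin n → Y₁, ∑ y₂ : Fin n → Y₂, (∏ i, C.channelProb (s i) (e₁ n w₁ s i) (e₂ n w₂ s i)
        (y₁ i) (y₂ i)) * ind (d₁ n y₁ ≠ w₁ ∨ d₂ n y₂ ≠ w₂) = C.errorProb (c n) w₁ w₂ := by
    intro n w₁ w₂
    unfold errorProb
    rw [sum_sum_arrow]
    refine Finset.sum_congr rfl fun s _ => ?_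
    congr 1
    refine Finset.sum_congr rfl fun y₁ _ => Finset.sum_congr rfl fun y₂ _ => ?_
    congr 1
    have hiff : (d₁ n y₁ ≠ w₁ ∨ d₂ n y₂ ≠ w₂) ↔ (d₁ n y₁, d₂ n y₂) ≠ (w₁, w₂) := by
      rw [Ne, Ne, Ne, Prod.mk.injEq, not_and_or]
    split_ifs with h
    · exact ind_of (hiff.mpr h)
    · exact ind_of_not fun h' => h (hiff.mp h')
  refine ⟨hR₁, hR₂, c, ?_⟩
  have havg : (fun n => C.avgErrorProb (c n)) = fun n : ℕ =>
      1 / ((⌈(2 : ℝ) ^ (n * R₁)⌉₊ : ℝ) * ⌈(2 : ℝ) ^ (n * R₂)⌉₊) *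
        ∑ w₁, ∑ w₂, C.errorProb (c n) w₁ w₂ := rfl
  simp_rw [← herr] at havg
  exact havg ▸ hlim

end StateIC

theorem proposition1 {S₁ S₂ X₁ X₂ Y₁ Y₂ : Type*}
    [Fintype S₁] [Fintype S₂] [Fintype X₁] [Fintype X₂] [Fintype Y₁] [Fintype Y₂]
    (C : StateIC S₁ S₂ X₁ X₂ Y₁ Y₂) :
    C.innerRegion ⊆ C.capacityRegion ∧
    ∀ (U V : Type) [Fintype U] [Fintype V] (p : StateIC.AuxLaw S₁ S₂ X₁ X₂ U V) (R₁ R₂ : ℝ),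
      0 ≤ R₁ → 0 ≤ R₂ → R₁ < C.bound₁ p → R₂ < C.bound₂ p → (R₁, R₂) ∈ C.achievable := by
  refine ⟨?_, ?_⟩
  · rintro ⟨R₁, R₂⟩ ⟨hR₁, hR₂, U, V, _, _, p, h₁, h₂⟩
    simp only [StateIC.bound₁, StateIC.bound₂, le_sub_iff_add_le, le_min_iff] at h₁ h₂ hR₁ hR₂
    obtain ⟨h₁a, h₁b⟩ := h₁
    obtain ⟨h₂a, h₂b⟩ := h₂
    -- lowering each rate by `δ`, but not below `0`, gives achievable pairs: a positive rate obeys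
    -- strict inequalities after that, and a rate that is `0` imposes no condition on its receiver
    have hmem : ∀ δ : ℝ, 0 < δ → (max (R₁ - δ) 0, max (R₂ - δ) 0) ∈ C.achievable := by
      intro δ hδ
      have hle₁ : max (R₁ - δ) 0 ≤ R₁ := max_le (by linarith) hR₁
      have hle₂ : max (R₂ - δ) 0 ≤ R₂ := max_le (by linarith) hR₂
      refine C.mem_achievable p (le_max_right _ _) (le_max_right _ _) ?_ ?_
      · rcases le_or_gt (R₁ - δ) 0 with h | h
        · exact Or.inl (max_eq_right h)
        · refine Or.inr ⟨?_, ?_⟩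
          · rw [max_eq_left h.le]
            exact (by linarith : _ < R₁ + _).trans_le h₁a
          · rw [max_eq_left h.le]
            refine lt_of_lt_of_le ?_ (add_le_add h₁a h₂b)
            linarith
      · rcases le_or_gt (R₂ - δ) 0 with h | h
        · exact Or.inl (max_eq_right h)
        · refine Or.inr ⟨?_, ?_⟩
          · rw [max_eq_left h.le]
            exact (by linarith : _ < R₂ + _).trans_le h₂a
          · rw [max_eq_left h.le]
            refine lt_of_lt_of_le ?_ (add_le_add h₂a h₁b)
            linarith
    have hlim : Tendsto (fun δ : ℝ => (max (R₁ - δ) 0, max (R₂ - δ) 0)) (𝓝[>] 0) (𝓝 (R₁, R₂)) := by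
      have hc : Continuous fun δ : ℝ => (max (R₁ - δ) 0, max (R₂ - δ) 0) := by fun_prop
      have h0 := hc.tendsto 0
      simp only [sub_zero, max_eq_left hR₁, max_eq_left hR₂] at h0
      exact h0.mono_left nhdsWithin_le_nhds
    exact mem_closure_of_tendsto hlim (eventually_nhdsWithin_of_forall fun δ hδ => hmem δ hδ)
  · intro U V _ _ p R₁ R₂ hR₁ hR₂ h₁ h₂
    simp only [StateIC.bound₁, StateIC.bound₂, lt_sub_iff_add_lt, lt_min_iff] at h₁ h₂
    obtain ⟨h₁a, h₁b⟩ := h₁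
    obtain ⟨h₂a, h₂b⟩ := h₂
    refine C.mem_achievable p hR₁ hR₂ (Or.inr ⟨h₁a, ?_⟩) (Or.inr ⟨h₂a, ?_⟩)
    · refine lt_of_le_of_lt ?_ (add_lt_add h₁a h₂b)
      linarith
    · refine lt_of_le_of_lt ?_ (add_lt_add h₂a h₁b)
      linarith
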